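/- **Conventions.** An *incidence complex of rank $k$* ($k$-complex) is a partially ordered set $\mathcal K$ of *faces* such that: (I1) there are a least face $F_{-1}$ and a greatest face $F_k$; (I2) every chain lies in a maximal chain with exactly $k+2$ elements (a *flag*), so that faces have ranks $-1,0,\dots,k$; (I3) any two flags $\Phi,\Psi$ are joined by a finite sequence of flags, all containing $\Phi\cap\Psi$, in which successive flags differ in just one face; (I4) there are finite numbers $c_0,\dots,c_{k-1}\ge 2$ such that for faces $F<G$ of ranks $i-1$ and $i+1$ there are exactly $c_i$ faces $H$ of rank $i$ with $F<H<G$. Faces of rank $0$ are *vertices*. $\Gamma(\mathcal K)$ is the group of order automorphisms; $\mathcal K$ is *regular* if $\Gamma(\mathcal K)$ is transitive on flags, a *polytope* if all $c_i=2$, and *vertex-describable* if distinct faces have distinct sets of vertices below them. Let $d\ge 1$ and let $\mathcal L$ be a universal regular $d$-polytope of type $\{q_1,\dots,q_{d-1}\}$, $q_j\in\{2,3,\dots,\infty\}$. Here, if $\rho_0,\dots,\rho_{d-1}$ are the distinguished generators of the automorphism group of a regular $d$-polytope ($\rho_i$ maps a fixed base flag to its $i$-adjacent flag), the type is given by $q_j=$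 order of $\rho_{j-1}\rho_j$; and $\mathcal L$ is *universal* if it covers every regular $d$-polytope of the same type, that is, for each such polytope $\mathcal{Q}$ there is a surjective map $\mathcal L\to\mathcal Q$ preserving order, rank and adjacency of flags. Let $\rho_0,\dots,\rho_{d-1}$ be the distinguished generators of $\Gamma(\mathcal L)$ for some base flag. Let $k\ge 1$, let $\mathcal K$ be a finite vertex-describable regular $k$-complex with vertex set $V$ and base flag $\Phi=\{F_{-1},F_0,\dots,F_k\}$, and for $-1\le i\le k$ let $R_i=\{\varphi\in\Gamma(\mathcal K): F_j\varphi=F_j \text{ for all } j\ne i\}$; thus $R_{-1}=R_k$ is the stabilizer of $\Phi$. Let $\mathcal D$ be the Coxeter diagram with node set $\{0,\dots,d-2\}\cup V$ in which, for $1\le j\le d-2$, the nodes $j-1,j$ are joined by a branch marked $q_j$, in which (if $d\ge2$) each $G\in V$ is joined to $d-2$ by a branch marked $q_{d-1}$, and which has no other branches. (A branch marked $2$ is the same as no branch.) Let $W=\langle\sigma_H : H\in V\cup\{0,\dots,d-2\}\rangle$ be the Coxeter group with diagram $\mathcal D$. $\Gamma(\mathcal K)$ acts on $W$ by group automorphisms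 fixing $\sigma_0,\dots,\sigma_{d-2}$ and permuting the $\sigma_G$, $G\in V$, as it permutes the vertices; let $W\rtimes\Gamma(\mathcal K)$ be the corresponding semi-direct product. **Theorem.** The assignment $\rho_i\mapsto\sigma_i$ ($0\le i\le d-2$), $\rho_{d-1}\mapsto\sigma_{F_0}$ extends to an injective homomorphism $\Gamma(\mathcal L)\to W$; regard $\Gamma(\mathcal L)$ as a subgroup of $W$ in this way. Put $$\widehat R_i=\langle\rho_i\rangle\ (0\le i\le d-1),\qquad \widehat R_i=R_{i-d}\ (d\le i\le d+k-1),\qquad \widehat R_{-1}=\widehat R_{d+k}=R_{-1},$$ and $\Gamma=\langle\widehat R_0,\dots,\widehat R_{d+k-1}\rangle\le W\rtimes\Gamma(\mathcal K)$. Then: 1. $\Gamma=W\rtimes\Gamma(\mathcal K)$. 2. For $-1\le i\le d+k$ let $\Gamma^{(i)}=\langle\widehat R_j : -1\le j\le d+k,\ j\ne i\rangle$. The set $\mathcal L^{\mathcal K}$ of all cosets of $\Gamma^{(i)}$ in $\Gamma$, $-1\le i\le d+k$ (one copy for each $i$), where a coset of $\Gamma^{(i)}$ is below a coset of $\Gamma^{(j)}$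 if and only if $i\le j$ and the two cosets intersect, is a partially ordered set and a regular incidence complex of rank $d+k$. The group $\Gamma$ acts on it faithfully by translation, as a flag-transitive subgroup of the automorphism group of $\mathcal L^{\mathcal K}$. -/

import Mathlib

/-! ## Incidence complexes -/

section Incidence

variable {α : Type*} [PartialOrder α]

/-- The rank of a face: one less than the length of a longest chain ending in it, so that the
least face has rank `-1`, the vertices have rank `0`, and so on. -/
noncomputable def faceRank (F : α) : ℤ := ((Order.height F).toNat : ℤ) - 1

/-- Two sets of faces differ in just one face (used for flags, which all have the same size). -/
def AdjacentSets (A B : Set α) : Prop := (A \ B).encard = 1 ∧ (B \ A).encard = 1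

/-- Two sets of faces (flags) are `i`-adjacent: they are distinct and have the same faces of each
rank other than `i`. -/
def IAdjacent (i : ℤ) (A B : Set α) : Prop :=
  A ≠ B ∧ ∀ F : α, faceRank F ≠ i → (F ∈ A ↔ F ∈ B)

variable (α) in
/-- `α` is an incidence complex of rank `k` with (finite) cardinal numbers `c 0, …, c (k - 1)`.
`Flag α` is the type of maximal chains of `α`. -/
structure IsIncidenceComplexWith (k : ℕ) (c : ℕ → ℕ) : Prop where
  /-- (I1) there is a least face -/
  exists_least : ∃ F : α, IsBot F
  /-- (I1) there is a greatest face -/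
  exists_greatest : ∃ F : α, IsTop F
  /-- (I2) each chain lies in a maximal chain with exactly `k + 2` elements -/
  chain_subset_flag : ∀ C : Set α, IsChain (· ≤ ·) C →
    ∃ Φ : Flag α, C ⊆ (Φ : Set α) ∧ (Φ : Set α).encard = k + 2
  /-- (I3) strong flag-connectedness -/
  strongly_connected : ∀ Φ Ψ : Flag α,
    Relation.ReflTransGen
      (fun A B : Flag α => AdjacentSets (A : Set α) (B : Set α) ∧
        (Φ : Set α) ∩ (Ψ : Set α) ⊆ (A : Set α) ∧ (Φ : Set α) ∩ (Ψ : Set α) ⊆ (B : Set α)) Φ Ψ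
  /-- (I4) each cardinal number is at least two -/
  two_le : ∀ i, i < k → 2 ≤ c i
  /-- (I4) between incident faces of ranks `i - 1` and `i + 1` there are `c i` faces of rank `i` -/
  card_between : ∀ i, i < k → ∀ F G : α, faceRank F = (i : ℤ) - 1 → faceRank G = (i : ℤ) + 1 →
    F < G → {H : α | faceRank H = i ∧ F < H ∧ H < G}.encard = c i

variable (α) in
/-- `α` is an incidence complex of rank `k`, or `k`-complex. -/
def IsIncidenceComplex (k : ℕ) : Prop := ∃ c : ℕ → ℕ, IsIncidenceComplexWith α k c

/-- A subgroup of the automorphism group `α ≃o α` that is transitive on flags. -/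
def IsFlagTransitive (G : Subgroup (α ≃o α)) : Prop :=
  ∀ Φ Ψ : Flag α, ∃ g ∈ G, g '' (Φ : Set α) = (Ψ : Set α)

variable (α) in
/-- `α` is a regular `k`-complex: the full automorphism group is flag-transitive. -/
def IsRegularComplex (k : ℕ) : Prop :=
  IsIncidenceComplex α k ∧ IsFlagTransitive (⊤ : Subgroup (α ≃o α))

variable (α) in
/-- `α` is a regular abstract `d`-polytope. -/
def IsRegularPolytope (d : ℕ) : Prop :=
  IsIncidenceComplexWith α d (fun _ => 2) ∧ IsFlagTransitive (⊤ : Subgroup (α ≃o α))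

/-- `ρ 0, …, ρ (d - 1)` are the distinguished generators of the group of a regular `d`-polytope
with respect to the base flag `Φ`: `ρ i` maps `Φ` to its `i`-adjacent flag. -/
def IsDistinguished {d : ℕ} (Φ : Flag α) (ρ : Fin d → (α ≃o α)) : Prop :=
  ∀ i : Fin d, IAdjacent ((i : ℕ) : ℤ) (Φ : Set α) (ρ i '' (Φ : Set α))

variable (α) in
/-- The regular `d`-polytope `α` has Schläfli type `{q 1, …, q (d - 1)}`: the product
`ρ_{j-1} ρ_j` of distinguished generators has order `q j`. The value `q j = 0` stands for `∞`. -/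
def HasSchlafliType (d : ℕ) (q : ℕ → ℕ) : Prop :=
  ∃ (Φ : Flag α) (ρ : Fin d → (α ≃o α)), IsDistinguished Φ ρ ∧
    ∀ i j : Fin d, (j : ℕ) = i + 1 → orderOf (ρ i * ρ j) = q j

/-- A covering: a surjective, order preserving map that preserves ranks and adjacency of flags. -/
structure IsCovering {β : Type*} [PartialOrder β] (f : α → β) : Prop where
  monotone : Monotone f
  surjective : Function.Surjective f
  rank_eq : ∀ F, faceRank (f F) = faceRank F
  adjacent : ∀ A B : Flag α, AdjacentSets (A : Set α) (B : Set α) →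
    AdjacentSets (f '' (A : Set α)) (f '' (B : Set α))

end Incidence

/-- `L` is a universal regular `d`-polytope of type `{q 1, …, q (d - 1)}`: it covers each regular
`d`-polytope of that type. -/
def IsUniversalRegularPolytope.{u} (L : Type u) [PartialOrder L] (d : ℕ) (q : ℕ → ℕ) : Prop :=
  IsRegularPolytope L d ∧ HasSchlafliType L d q ∧
    ∀ (Q : Type u) [PartialOrder Q], IsRegularPolytope Q d → HasSchlafliType Q d q →
      ∃ f : L → Q, IsCovering f

section Vertices

variable (K : Type*) [PartialOrder K]

/-- The vertices of a complex. -/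
def Vertex : Type _ := {F : K // faceRank F = 0}

/-- Faces are uniquely determined by their vertex-sets. -/
def IsVertexDescribable : Prop :=
  ∀ F G : K, (∀ v : Vertex K, v.1 ≤ F ↔ v.1 ≤ G) → F = G

variable {K}

/-- The subgroup `R i` of the automorphism group: all automorphisms that fix every face of the
base flag `Φ` except possibly the one of rank `i`. For `i = -1` and `i = k` this is the
stabilizer of `Φ`. -/
def distinguishedSubgroup (Φ : Flag K) (i : ℤ) : Subgroup (K ≃o K) where
  carrier := {g | ∀ F ∈ Φ, faceRank F ≠ i → g F = F}
  one_mem' := fun _ _ _ => rfl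
  mul_mem' := by
    intro a b ha hb F hF hi
    change a (b F) = F
    rw [hb F hF hi, ha F hF hi]
  inv_mem' := by
    intro a ha F hF hi
    change a.symm F = F
    rw [OrderIso.symm_apply_eq, ha F hF hi]

theorem faceRank_orderIso (g : K ≃o K) (F : K) : faceRank (g F) = faceRank F := by
  unfold faceRank
  rw [Order.height_orderIso]

/-- The action of an automorphism of `K` on the vertices. -/
def vertexMap (g : K ≃o K) (v : Vertex K) : Vertex K :=
  ⟨g v.1, (faceRank_orderIso g v.1).trans v.2⟩

end Vertices

/-! ## The merged Coxeter diagram and its Coxeter group -/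

section Twist

variable (K : Type*) [PartialOrder K]

/-- The nodes of the merged diagram: the nodes `0, …, d - 2` of the string diagram, and the
vertices of `K`. -/
abbrev MergedNode (d : ℕ) : Type _ := Fin (d - 1) ⊕ Vertex K

open Classical in
/-- The Coxeter matrix entries of the merged diagram: nodes `j - 1` and `j` of the string are
joined by a branch marked `q j`, each vertex of `K` is joined to the node `d - 2` by a branch marked
`q (d - 1)`, and there are no other branches. The value `0` stands for the mark `∞`. -/
noncomputable def mergedEntry (d : ℕ) (q : ℕ → ℕ) : MergedNode K d → MergedNode K d → ℕ
  | .inl i, .inl j =>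
      if i = j then 1
      else if (i : ℕ) + 1 = j then q j
      else if (j : ℕ) + 1 = i then q i
      else 2
  | .inl i, .inr _ => if (i : ℕ) + 2 = d then q (d - 1) else 2
  | .inr _, .inl j => if (j : ℕ) + 2 = d then q (d - 1) else 2
  | .inr G, .inr H => if G = H then 1 else 2

/-- The merged diagram as a Coxeter matrix. -/
noncomputable def mergedMatrix (d : ℕ) (q : ℕ → ℕ) (hq : ∀ j, q j ≠ 1) :
    CoxeterMatrix (MergedNode K d) where
  M := Matrix.of (mergedEntry K d q)
  isSymm := by
    ext x y
    rcases x with i | G <;> rcases y with j | H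
    · simp only [Matrix.transpose_apply, Matrix.of_apply, mergedEntry, Fin.ext_iff]
      split_ifs <;> first | rfl | omega
    · rfl
    · rfl
    · by_cases h : G = H
      · subst h
        rfl
      · simp only [Matrix.transpose_apply, Matrix.of_apply, mergedEntry, if_neg h,
          if_neg (Ne.symm h)]
  diagonal := by
    rintro (i | G) <;> simp [mergedEntry]
  off_diagonal := by
    rintro (i | G) (j | H) h <;> simp only [Matrix.of_apply, mergedEntry]
    · have h' : i ≠ j := fun e => h (by rw [e])
      rw [if_neg h']
      split_ifs <;> first | exact hq _ | decide
    · split_ifs <;> first | exact hq _ | decide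
    · split_ifs <;> first | exact hq _ | decide
    · have h' : G ≠ H := fun e => h (by rw [e])
      rw [if_neg h']
      decide

variable {K}

/-- The action of an automorphism of `K` on the nodes of the merged diagram: the nodes
`0, …, d - 2` are fixed and the vertices of `K` are permuted as in `K`. -/
def nodeMap (d : ℕ) (g : K ≃o K) : MergedNode K d → MergedNode K d :=
  Sum.map id (vertexMap g)

theorem vertexMap_injective (g : K ≃o K) : Function.Injective (vertexMap g) := by
  intro v w h
  exact Subtype.ext (g.injective (congrArg Subtype.val h))

theorem mergedMatrix_nodeMap (d : ℕ) (q : ℕ → ℕ) (hq : ∀ j, q j ≠ 1) (g : K ≃o K)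
    (x y : MergedNode K d) :
    mergedMatrix K d q hq (nodeMap d g x) (nodeMap d g y) = mergedMatrix K d q hq x y := by
  rcases x with i | G <;> rcases y with j | H
  · rfl
  · rfl
  · rfl
  · change mergedEntry K d q (.inr (vertexMap g G)) (.inr (vertexMap g H)) =
      mergedEntry K d q (.inr G) (.inr H)
    by_cases h : G = H
    · subst h
      simp only [mergedEntry, if_true]
    · have h' : vertexMap g G ≠ vertexMap g H := fun e => h (vertexMap_injective g e)
      simp only [mergedEntry, if_neg h, if_neg h']

/-- The endomorphism of the Coxeter group `W` of the merged diagram with `σ_H ↦ σ_{g H}`. -/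
noncomputable def coxeterEnd (d : ℕ) (q : ℕ → ℕ) (hq : ∀ j, q j ≠ 1) (g : K ≃o K) :
    (mergedMatrix K d q hq).Group →* (mergedMatrix K d q hq).Group :=
  (mergedMatrix K d q hq).toCoxeterSystem.lift
    ⟨fun x => (mergedMatrix K d q hq).simple (nodeMap d g x), by
      intro x y
      rw [← mergedMatrix_nodeMap d q hq g x y]
      exact (mergedMatrix K d q hq).toCoxeterSystem.simple_mul_simple_pow _ _⟩

theorem coxeterEnd_simple (d : ℕ) (q : ℕ → ℕ) (hq : ∀ j, q j ≠ 1) (g : K ≃o K)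
    (x : MergedNode K d) :
    coxeterEnd d q hq g ((mergedMatrix K d q hq).simple x) =
      (mergedMatrix K d q hq).simple (nodeMap d g x) :=
  (mergedMatrix K d q hq).toCoxeterSystem.lift_apply_simple _ x

theorem nodeMap_mul (d : ℕ) (g h : K ≃o K) (x : MergedNode K d) :
    nodeMap d (g * h) x = nodeMap d g (nodeMap d h x) := by
  rcases x with i | G <;> rfl

theorem nodeMap_one (d : ℕ) (x : MergedNode K d) : nodeMap d (1 : K ≃o K) x = x := by
  rcases x with i | G <;> rfl

theorem coxeterEnd_mul (d : ℕ) (q : ℕ → ℕ) (hq : ∀ j, q j ≠ 1) (g h : K ≃o K) :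
    coxeterEnd d q hq (g * h) = (coxeterEnd d q hq g).comp (coxeterEnd d q hq h) := by
  apply (mergedMatrix K d q hq).toCoxeterSystem.ext_simple
  intro x
  simp only [CoxeterMatrix.toCoxeterSystem_simple, MonoidHom.comp_apply, coxeterEnd_simple,
    nodeMap_mul]

theorem coxeterEnd_one (d : ℕ) (q : ℕ → ℕ) (hq : ∀ j, q j ≠ 1) :
    coxeterEnd d q hq (1 : K ≃o K) = MonoidHom.id _ := by
  apply (mergedMatrix K d q hq).toCoxeterSystem.ext_simple
  intro x
  simp only [CoxeterMatrix.toCoxeterSystem_simple, MonoidHom.id_apply, coxeterEnd_simple,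
    nodeMap_one]

variable (K) in
/-- The action of the automorphism group of `K` on the Coxeter group `W` of the merged diagram by
group automorphisms permuting the generators. -/
noncomputable def coxeterAction (d : ℕ) (q : ℕ → ℕ) (hq : ∀ j, q j ≠ 1) :
    (K ≃o K) →* MulAut (mergedMatrix K d q hq).Group where
  toFun g := MonoidHom.toMulEquiv (coxeterEnd d q hq g) (coxeterEnd d q hq g⁻¹)
    (by rw [← coxeterEnd_mul, inv_mul_cancel, coxeterEnd_one])
    (by rw [← coxeterEnd_mul, mul_inv_cancel, coxeterEnd_one])
  map_one' := by
    ext x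
    exact DFunLike.congr_fun (coxeterEnd_one d q hq) x
  map_mul' g h := by
    ext x
    exact DFunLike.congr_fun (coxeterEnd_mul d q hq g h) x

variable (K) in
/-- The semi-direct product of `W` with the automorphism group of `K`, in which
`g σ_H g⁻¹ = σ_{g H}` (automorphisms act from the left). -/
abbrev TwistProduct (d : ℕ) (q : ℕ → ℕ) (hq : ∀ j, q j ≠ 1) : Type _ :=
  (mergedMatrix K d q hq).Group ⋊[coxeterAction K d q hq] (K ≃o K)

/-- The generator `ρ_i` (`0 ≤ i ≤ d - 1`) as an element of `W`: it is `σ_i` if `i ≤ d - 2`, and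
the generator of the base vertex `F₀` if `i = d - 1`. -/
noncomputable def stringGenerator (d : ℕ) (q : ℕ → ℕ) (hq : ∀ j, q j ≠ 1) (F₀ : Vertex K)
    (i : ℕ) : (mergedMatrix K d q hq).Group :=
  if h : i < d - 1 then (mergedMatrix K d q hq).simple (.inl ⟨i, h⟩)
  else (mergedMatrix K d q hq).simple (.inr F₀)

/-- The subgroups `R̂ i` for `-1 ≤ i ≤ d + k`, where `Φ` is the base flag of `K` and `F₀` its
vertex: `⟨ρ_i⟩` if `0 ≤ i ≤ d - 1`, `R (i - d)` if `d ≤ i ≤ d + k - 1`, and, for the two improper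
ranks `-1` and `d + k`, the stabilizer `R (-1) = R k` of `Φ`. -/
noncomputable def hatSubgroup (d : ℕ) (q : ℕ → ℕ) (hq : ∀ j, q j ≠ 1) (Φ : Flag K)
    (F₀ : Vertex K) (i : ℤ) : Subgroup (TwistProduct K d q hq) :=
  if i < 0 then (distinguishedSubgroup Φ (-1)).map SemidirectProduct.inr
  else if i < d then
    Subgroup.zpowers (SemidirectProduct.inl (stringGenerator d q hq F₀ i.toNat))
  else (distinguishedSubgroup Φ (i - d)).map SemidirectProduct.inr

/-- The group `Γ = ⟨R̂ 0, …, R̂ (d + k - 1)⟩`. -/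
noncomputable def twistGroup (d k : ℕ) (q : ℕ → ℕ) (hq : ∀ j, q j ≠ 1) (Φ : Flag K)
    (F₀ : Vertex K) : Subgroup (TwistProduct K d q hq) :=
  ⨆ i ∈ Set.Icc (0 : ℤ) (d + k - 1), hatSubgroup d q hq Φ F₀ i

end Twist

/-! ## The complex of cosets attached to a system of subgroups `R (-1), R 0, …, R n` -/

section Cosets

variable {G : Type*} [Group G]

/-- The subgroup generated by all `R j` with `j ∈ {-1, 0, …, n}` and `j ≠ i`. -/
def corankSubgroup (n : ℤ) (R : ℤ → Subgroup G) (i : ℤ) : Subgroup G :=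
  ⨆ j ∈ Set.Icc (-1 : ℤ) n \ {i}, R j

/-- The faces: for each rank `i ∈ {-1, 0, …, n}`, the cosets of the subgroup generated by the
`R j` with `j ≠ i`. -/
def CosetFace (n : ℤ) (R : ℤ → Subgroup G) : Type _ :=
  Σ i : Set.Icc (-1 : ℤ) n, G ⧸ corankSubgroup n R i

/-- Incidence: the rank of the first coset is at most the rank of the second one, and the two
cosets have an element in common. -/
def CosetFace.Le {n : ℤ} {R : ℤ → Subgroup G} (x y : CosetFace n R) : Prop :=
  x.1 ≤ y.1 ∧ ∃ g : G, (QuotientGroup.mk g : G ⧸ corankSubgroup n R x.1) = x.2 ∧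
    (QuotientGroup.mk g : G ⧸ corankSubgroup n R y.1) = y.2

/-- Translation of a coset by a group element. -/
def CosetFace.translate {n : ℤ} {R : ℤ → Subgroup G} (g : G) (x : CosetFace n R) :
    CosetFace n R :=
  ⟨x.1, g • x.2⟩

end Cosets

/-- The faces of the complex `L^K`, obtained from `R̂ (-1), …, R̂ (d + k)`. -/
abbrev TwistComplex {K : Type*} [PartialOrder K] (d k : ℕ) (q : ℕ → ℕ) (hq : ∀ j, q j ≠ 1)
    (Φ : Flag K) (F₀ : Vertex K) : Type _ :=
  CosetFace ((d : ℤ) + k) (hatSubgroup d q hq Φ F₀)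

/-!
The theorem rests on three facts.

*Coset complexes.* Let subgroups `R (-1), R 0, …, R n = R (-1)` of a group be given such that
non-neighbouring ones permute, and such that an element of all the subgroups `Γ_i = ⟨R j : j ≠ i⟩`
with `i ∉ J` is a product of elements of `R (-1)` and of the `R j` with `j ∈ J`. Then an element of
`Γ_i` splits into a part from the `R j` with `j > i` and a part from the `R j` with `j < i`, hence
each chain of cosets has a common element. So the flags are exactly the sets of all cosets that
contain a given group element, and the axioms of an incidence complex translate into statements on
the subgroups (`IsRankedSystem.isIncidenceComplexWith`, `IsRankedSystem.isFlagTransitive_range`).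

*Parabolic subgroups of Coxeter groups.* An intersection of standard parabolic subgroups is the
parabolic subgroup of the intersection (`CoxeterSystem.mem_parabolic_iInter`). The right descents of
an element lie in each parabolic subgroup containing it, since the parity of the number of
occurrences of a reflection in an inversion sequence depends only on the element. The geometric
representation shows that no simple reflection lies in the parabolic subgroup of the others.

*String Coxeter groups.* By the two facts above, the string Coxeter group of type
`{q 1, …, q (d - 1)}` is the automorphism group of a regular polytope of this type. The universal
polytope covers it, whence the group of the universal polytope is the Coxeter group itself
(`exists_mulEquiv_of_universal`). It embeds into `W`, and identifying all vertices of `K` provides a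
left inverse (`exists_injective_stringGenerator`).

For the twisted group the subgroup `Γ_i` is contained in the semi-direct product of a parabolic
subgroup of `W` and a face stabilizer of `K` (`faceSubgroup`). The intersection property follows from
the one of `W`, because the vertices below given faces of the base flag of `K` form an orbit of the
common stabilizer of these faces (`mem_spannedSubgroup_of_forall_mem`). The action is faithful as an
automorphism of `K` is determined by its action on the vertices, that is, on generators of `W`.
-/

/-! ### Parabolic subgroups of Coxeter groups -/

namespace CoxeterMatrix

variable {B : Type*} (M : CoxeterMatrix B)

/-- The linear form `2 ⟨e_i, ·⟩` on the root space `B →₀ ℝ`, where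
`⟨e_i, e_j⟩ = - cos (π / M i j)`. For `M i j = 0`, the mark `∞`, division by zero gives the
correct value `⟨e_i, e_j⟩ = -1`. -/
noncomputable def coroot (i : B) : Module.Dual ℝ (B →₀ ℝ) :=
  Finsupp.linearCombination ℝ fun j => -2 * Real.cos (Real.pi / M i j)

theorem coroot_single (i j : B) :
    M.coroot i (Finsupp.single j 1) = -2 * Real.cos (Real.pi / M i j) := by
  simp [coroot]

theorem coroot_single_self (i : B) : M.coroot i (Finsupp.single i 1) = 2 := by
  simp [coroot_single]

/-- The reflection of the root space attached to a node. -/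
noncomputable def rootReflection (i : B) : (B →₀ ℝ) ≃ₗ[ℝ] (B →₀ ℝ) :=
  Module.reflection (M.coroot_single_self i)

theorem rootReflection_apply (i : B) (v : B →₀ ℝ) :
    M.rootReflection i v = v - M.coroot i v • Finsupp.single i 1 :=
  Module.reflection_apply _ _

open Polynomial.Chebyshev in
/-- The product of the reflections attached to two nodes has the order prescribed by the matrix:
on the plane spanned by the two roots it is a rotation through `2π / m`, which shows in the values
`S_n (2 cos (2π / m)) = sin ((n + 1) 2π / m) / sin (2π / m)` of the Chebyshev polynomials. -/
theorem rootReflection_isLiftable : M.IsLiftable M.rootReflection := by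
  intro i j
  rcases eq_or_ne (M i j) 0 with h0 | h0
  · rw [h0, pow_zero]
  have hij : M.coroot i (Finsupp.single j 1) = -2 * Real.cos (Real.pi / M i j) :=
    M.coroot_single i j
  have hji : M.coroot j (Finsupp.single i 1) = -2 * Real.cos (Real.pi / M i j) := by
    rw [M.coroot_single j i, M.symmetric]
  set m := M i j with hm
  have ht : 2 * Real.cos (2 * Real.pi / m) =
      M.coroot i (Finsupp.single j 1) * M.coroot j (Finsupp.single i 1) - 2 := by
    rw [hij, hji, show 2 * Real.pi / (m : ℝ) = 2 * (Real.pi / m) by ring, Real.cos_two_mul]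
    ring
  ext1 v
  change ((Module.reflection (M.coroot_single_self i) *
    Module.reflection (M.coroot_single_self j)) ^ m) v = v
  obtain h1 | h2 | h3 : m = 1 ∨ m = 2 ∨ 3 ≤ m := by omega
  · have : i = j := by
      by_contra hne
      exact M.off_diagonal i j hne h1
    subst this
    rw [h1, pow_one, LinearEquiv.mul_apply]
    exact Module.involutive_reflection _ v
  · rw [h2] at hij hji ⊢
    simp only [Nat.cast_ofNat, Real.cos_pi_div_two, mul_zero] at hij hji
    simp only [pow_two, LinearEquiv.mul_apply, Module.reflection_apply, map_sub, map_smul, hij, hji,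
      M.coroot_single_self]
    module
  · rw [Module.reflection_mul_reflection_pow_apply _ _ m v _ ht]
    have hm0 : (m : ℝ) ≠ 0 := by exact_mod_cast h0
    have hsin : Real.sin (2 * Real.pi / m) ≠ 0 := by
      apply ne_of_gt
      apply Real.sin_pos_of_pos_of_lt_pi
      · have := Real.pi_pos
        positivity
      · rw [div_lt_iff₀ (by positivity)]
        have : (3 : ℝ) ≤ m := by exact_mod_cast h3
        nlinarith [Real.pi_pos]
    have key : ∀ n n' : ℤ, n + n' + 2 = m →
        (S ℝ n).eval (2 * Real.cos (2 * Real.pi / m)) =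
          - (S ℝ n').eval (2 * Real.cos (2 * Real.pi / m)) := by
      intro n n' h
      apply mul_right_cancel₀ hsin
      rw [neg_mul, S_two_mul_real_cos, S_two_mul_real_cos, ← Real.sin_neg,
        ← Real.sin_add_two_pi (-(_))]
      congr 1
      have : (n : ℝ) + n' + 2 = m := by exact_mod_cast h
      field_simp
      rw [← this]
      ring
    rcases Nat.even_or_odd' m with ⟨r, hr | hr⟩
    · have e1 : ((m : ℤ) - 2) / 2 = r - 1 := by omega
      have e2 : ((m : ℤ) - 1) / 2 = r - 1 := by omega
      have hz : (S ℝ ((r : ℤ) - 1)).eval (2 * Real.cos (2 * Real.pi / m)) = 0 := by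
        have := key (r - 1) (r - 1) (by omega)
        linarith
      rw [e1, e2, hz]
      simp
    · have e1 : ((m : ℤ) - 2) / 2 = r - 1 := by omega
      have e2 : ((m : ℤ) - 1) / 2 = r := by omega
      have e3 : ((m : ℤ) - 3) / 2 = r - 1 := by omega
      have e4 : (m : ℤ) / 2 = r := by omega
      have hz := key r (r - 1) (by omega)
      rw [e1, e2, e3, e4, hz]
      simp

end CoxeterMatrix

namespace CoxeterSystem

variable {B W : Type*} [Group W] {M : CoxeterMatrix B} (cs : CoxeterSystem M W)

/-- The standard parabolic subgroup generated by the simple reflections in `J`. -/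
def parabolic (J : Set B) : Subgroup W := Subgroup.closure (cs.simple '' J)

theorem simple_mem_parabolic {J : Set B} {i : B} (hi : i ∈ J) : cs.simple i ∈ cs.parabolic J :=
  Subgroup.subset_closure ⟨i, hi, rfl⟩

theorem parabolic_le {J : Set B} {H : Subgroup W} (h : ∀ i ∈ J, cs.simple i ∈ H) :
    cs.parabolic J ≤ H := by
  rw [parabolic, Subgroup.closure_le]
  rintro _ ⟨i, hi, rfl⟩
  exact h i hi

/-- The geometric representation of a Coxeter group on its root space. -/
noncomputable def geometricRep : W →* ((B →₀ ℝ) ≃ₗ[ℝ] (B →₀ ℝ)) :=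
  cs.lift ⟨M.rootReflection, M.rootReflection_isLiftable⟩

theorem geometricRep_simple (i : B) : cs.geometricRep (cs.simple i) = M.rootReflection i :=
  cs.lift_apply_simple _ i

/-- An element of a parabolic subgroup does not change the coordinates of a vector outside `J`. -/
theorem geometricRep_apply_of_mem_parabolic {J : Set B} {w : W} (hw : w ∈ cs.parabolic J) {i : B}
    (hi : i ∉ J) (v : B →₀ ℝ) : cs.geometricRep w v i = v i := by
  induction hw using Subgroup.closure_induction generalizing v with
  | mem x hx =>
    obtain ⟨j, hj, rfl⟩ := hx
    have hij : j ≠ i := fun e => hi (e ▸ hj)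
    rw [geometricRep_simple, M.rootReflection_apply]
    simp [hij]
  | one => simp
  | mul x y _ _ hx hy => rw [map_mul, LinearEquiv.mul_apply, hx, hy]
  | inv x _ hx =>
    rw [← hx (cs.geometricRep x⁻¹ v), ← LinearEquiv.mul_apply, ← map_mul, mul_inv_cancel, map_one]
    rfl

/-- A simple reflection lies in a parabolic subgroup only if it is one of its generators, since
`s_i` changes the sign of the `i`-th coordinate of the root `e_i`. -/
theorem simple_mem_parabolic_iff {J : Set B} {i : B} :
    cs.simple i ∈ cs.parabolic J ↔ i ∈ J := by
  refine ⟨fun h => ?_, cs.simple_mem_parabolic⟩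
  by_contra hi
  have h1 := cs.geometricRep_apply_of_mem_parabolic h hi (Finsupp.single i 1)
  rw [geometricRep_simple, M.rootReflection_apply, M.coroot_single_self] at h1
  norm_num at h1

theorem simple_injective : Function.Injective cs.simple := by
  intro i j h
  have : cs.simple i ∈ cs.parabolic {j} := by
    rw [h]
    exact cs.simple_mem_parabolic rfl
  exact Set.mem_singleton_iff.1 (cs.simple_mem_parabolic_iff.1 this)

open Classical in
/-- The map `(t, ε) ↦ (s_i t s_i, ε + [t = s_i])`. -/
noncomputable def reflectionStep (i : B) : Function.End (W × ZMod 2) := fun x =>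
  (cs.simple i * x.1 * cs.simple i, x.2 + if x.1 = cs.simple i then 1 else 0)

open Classical in
theorem reflectionStep_mul_pow (i j : B) (k : ℕ) (t : W) (ε : ZMod 2) :
    ((cs.reflectionStep i * cs.reflectionStep j) ^ k : Function.End (W × ZMod 2)) (t, ε) =
      ((cs.simple i * cs.simple j) ^ k * t * ((cs.simple i * cs.simple j) ^ k)⁻¹,
        ε + ∑ l ∈ Finset.range (2 * k),
          if t = ((cs.simple i * cs.simple j) ^ l)⁻¹ * cs.simple j then 1 else 0) := by
  induction k with
  | zero => simp; rfl
  | succ k ih =>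
    set c := cs.simple i * cs.simple j with hc
    have hcj : ∀ l : ℕ, cs.simple j * c ^ l = (c ^ l)⁻¹ * cs.simple j := by
      intro l
      induction l with
      | zero => simp
      | succ l ihl =>
        have h1 : cs.simple j * c = c⁻¹ * cs.simple j := by simp [hc, mul_assoc]
        rw [pow_succ, ← mul_assoc, ihl, mul_assoc, h1, ← mul_assoc, ← mul_inv_rev, ← pow_succ',
          ← pow_succ]
    have e1 : c ^ k * t * (c ^ k)⁻¹ = cs.simple j ↔ t = (c ^ (2 * k))⁻¹ * cs.simple j := by
      rw [mul_inv_eq_iff_eq_mul, hcj, ← eq_inv_mul_iff_mul_eq, ← mul_assoc, ← mul_inv_rev,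
        ← pow_add, two_mul]
    have e2 : cs.simple j * (c ^ k * t * (c ^ k)⁻¹) * cs.simple j = cs.simple i ↔
        t = (c ^ (2 * k + 1))⁻¹ * cs.simple j := by
      have h1 : ∀ x : W, cs.simple j * x * cs.simple j = cs.simple i ↔ x = c⁻¹ * cs.simple j := by
        intro x
        constructor
        · intro h
          rw [hc, mul_inv_rev, inv_simple, inv_simple, ← h]
          simp [mul_assoc]
        · rintro rfl
          simp [hc, mul_assoc]
      rw [h1, mul_inv_eq_iff_eq_mul, mul_assoc, hcj, ← mul_assoc, ← mul_inv_rev, ← pow_succ,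
        ← eq_inv_mul_iff_mul_eq, ← mul_assoc, ← mul_inv_rev, ← pow_add]
      rw [show k + 1 + k = 2 * k + 1 by ring]
    rw [pow_succ']
    change cs.reflectionStep i (cs.reflectionStep j
      (((cs.reflectionStep i * cs.reflectionStep j) ^ k : Function.End (W × ZMod 2)) (t, ε))) = _
    rw [ih]
    simp only [reflectionStep]
    rw [show 2 * (k + 1) = 2 * k + 1 + 1 by ring, Finset.sum_range_succ, Finset.sum_range_succ]
    simp only [e1, e2]
    ext1
    · simp only [pow_succ', hc, mul_inv_rev, inv_simple, mul_assoc]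
    · simp only [add_assoc]

/-- The cocycle identity for the braid relations: in the sum of `reflectionStep_mul_pow` with
`k = M i j` each term occurs twice. -/
theorem reflectionStep_isLiftable : M.IsLiftable cs.reflectionStep := by
  classical
  intro i j
  funext ⟨t, ε⟩
  rw [reflectionStep_mul_pow, cs.simple_mul_simple_pow, two_mul, Finset.sum_range_add]
  simp only [pow_add, cs.simple_mul_simple_pow, one_mul, inv_one, mul_one]
  rw [CharTwo.add_self_eq_zero, add_zero]
  rfl

/-- The action of `W` on `W × ZMod 2` in which `s_i` acts by `(t, ε) ↦ (s_i t s_i, ε + [t = s_i])`.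
The second component counts, modulo two, the occurrences of `t` in the right inversion sequence of
a word. -/
noncomputable def reflectionAction : W →* Function.End (W × ZMod 2) :=
  cs.lift ⟨cs.reflectionStep, cs.reflectionStep_isLiftable⟩

theorem reflectionAction_simple (i : B) :
    cs.reflectionAction (cs.simple i) = cs.reflectionStep i :=
  cs.lift_apply_simple _ i

/-- The parity of the number of occurrences of `t` in the right inversion sequence of any word
for `w`. -/
noncomputable def inversionParity (w t : W) : ZMod 2 := (cs.reflectionAction w (t, 0)).2

theorem reflectionAction_apply (w t : W) (ε : ZMod 2) :
    cs.reflectionAction w (t, ε) = (w * t * w⁻¹, ε + cs.inversionParity w t) := by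
  induction w using cs.simple_induction_left generalizing t ε with
  | one =>
    simp only [inversionParity, map_one]
    change (t, ε) = (1 * t * 1⁻¹, ε + 0)
    simp
  | mul_simple_left w i ih =>
    have h : ∀ t ε, cs.reflectionAction (cs.simple i * w) (t, ε) =
        cs.reflectionStep i (cs.reflectionAction w (t, ε)) := by
      intro t ε
      rw [map_mul, reflectionAction_simple]
      rfl
    rw [inversionParity, h, h, ih, ih]
    simp [reflectionStep, mul_assoc, add_assoc]

theorem inversionParity_one (t : W) : cs.inversionParity 1 t = 0 := by
  rw [inversionParity, map_one]
  rfl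

open Classical in
theorem inversionParity_simple (i : B) (t : W) :
    cs.inversionParity (cs.simple i) t = if t = cs.simple i then 1 else 0 := by
  rw [inversionParity, reflectionAction_simple]
  simp [reflectionStep]

theorem inversionParity_mul (u v t : W) :
    cs.inversionParity (u * v) t = cs.inversionParity v t + cs.inversionParity u (v * t * v⁻¹) := by
  rw [inversionParity, map_mul]
  change (cs.reflectionAction u (cs.reflectionAction v (t, 0))).2 = _
  rw [reflectionAction_apply, reflectionAction_apply, zero_add]

theorem mem_rightInvSeq_of_inversionParity_ne_zero (ω : List B) (t : W)
    (h : cs.inversionParity (cs.wordProd ω) t ≠ 0) : t ∈ cs.rightInvSeq ω := by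
  induction ω with
  | nil => exact absurd (cs.inversionParity_one t) h
  | cons i ω ih =>
    rw [wordProd_cons, inversionParity_mul, inversionParity_simple] at h
    rw [rightInvSeq, List.mem_cons]
    by_cases h1 : cs.wordProd ω * t * (cs.wordProd ω)⁻¹ = cs.simple i
    · left
      rw [← h1]
      group
    · rw [if_neg h1, add_zero] at h
      exact Or.inr (ih h)

/-- A right descent of `w` occurs an odd number of times in each right inversion sequence. -/
theorem inversionParity_ne_zero_of_isRightDescent {w : W} {i : B} (h : cs.IsRightDescent w i) :
    cs.inversionParity w (cs.simple i) ≠ 0 := by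
  intro h0
  obtain ⟨ω, hω, hw⟩ := cs.exists_isReduced (w * cs.simple i)
  have h1 : cs.inversionParity (w * cs.simple i) (cs.simple i) ≠ 0 := by
    rw [inversionParity_mul, inversionParity_simple]
    simp [h0]
  rw [hw] at h1
  have h2 := cs.isRightInversion_of_mem_rightInvSeq hω
    (cs.mem_rightInvSeq_of_inversionParity_ne_zero ω _ h1)
  have h3 := h2.2
  rw [← hw, simple_mul_simple_cancel_right] at h3
  exact absurd h (not_lt.2 h3.le)

theorem mem_parabolic_of_inversionParity_ne_zero {J : Set B} {w : W} (hw : w ∈ cs.parabolic J)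
    {t : W} (h : cs.inversionParity w t ≠ 0) : t ∈ cs.parabolic J := by
  induction hw using Subgroup.closure_induction generalizing t with
  | mem x hx =>
    obtain ⟨j, hj, rfl⟩ := hx
    rw [inversionParity_simple] at h
    have ht : t = cs.simple j := by
      by_contra hne
      exact h (if_neg hne)
    rw [ht]
    exact cs.simple_mem_parabolic hj
  | one => exact absurd (cs.inversionParity_one t) h
  | mul x y hx hy ihx ihy =>
    rw [inversionParity_mul] at h
    by_cases h1 : cs.inversionParity y t = 0
    · rw [h1, zero_add] at h
      have h2 := (cs.parabolic J).mul_mem ((cs.parabolic J).mul_mem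
        ((cs.parabolic J).inv_mem hy) (ihx h)) hy
      have h3 : y⁻¹ * (y * t * y⁻¹) * y = t := by group
      rwa [h3] at h2
    · exact ihy h1
  | inv x hx ih =>
    have h1 := cs.inversionParity_mul x x⁻¹ t
    rw [mul_inv_cancel, inversionParity_one, inv_inv] at h1
    have h2 : cs.inversionParity x (x⁻¹ * t * x) ≠ 0 := by
      intro h0
      rw [h0, add_zero] at h1
      exact h h1.symm
    have h3 := (cs.parabolic J).mul_mem ((cs.parabolic J).mul_mem hx (ih h2))
      ((cs.parabolic J).inv_mem hx)
    have h4 : x * (x⁻¹ * t * x) * x⁻¹ = t := by group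
    rwa [h4] at h3

theorem mem_of_isRightDescent_of_mem_parabolic {J : Set B} {w : W} {i : B}
    (hw : w ∈ cs.parabolic J) (h : cs.IsRightDescent w i) : i ∈ J :=
  cs.simple_mem_parabolic_iff.1 (cs.mem_parabolic_of_inversionParity_ne_zero hw
    (cs.inversionParity_ne_zero_of_isRightDescent h))

/-- The intersection of standard parabolic subgroups is the standard parabolic subgroup of the
intersection: right descents of a common element are generators of each of the subgroups, so that
they can be split off one after the other. -/
theorem mem_parabolic_iInter {ι : Sort*} {A : ι → Set B} {w : W}
    (hw : ∀ x, w ∈ cs.parabolic (A x)) : w ∈ cs.parabolic (⋂ x, A x) := by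
  induction hn : cs.length w using Nat.strong_induction_on generalizing w with
  | _ n ih =>
    by_cases h1 : w = 1
    · rw [h1]
      exact Subgroup.one_mem _
    obtain ⟨i, hi⟩ := cs.exists_rightDescent_of_ne_one h1
    have hiA : ∀ x, i ∈ A x := fun x => cs.mem_of_isRightDescent_of_mem_parabolic (hw x) hi
    have h2 := ih (cs.length (w * cs.simple i)) (hn ▸ hi)
      (fun x => (cs.parabolic (A x)).mul_mem (hw x) (cs.simple_mem_parabolic (hiA x))) rfl
    have h3 := (cs.parabolic (⋂ x, A x)).mul_mem h2
      (cs.simple_mem_parabolic (Set.mem_iInter.2 hiA))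
    rwa [simple_mul_simple_cancel_right] at h3

end CoxeterSystem

/-! ### Ranks and flags of incidence complexes -/

section Height

variable {α : Type*} [PartialOrder α]

theorem card_le_height_of_isChain {C : Finset α} (hC : IsChain (· ≤ ·) (C : Set α)) {F : α}
    (hF : ∀ x ∈ C, x < F) : (C.card : ℕ∞) ≤ Order.height F := by
  classical
  induction hn : C.card generalizing C F with
  | zero => simp
  | succ n ih =>
    have hne : C.Nonempty := Finset.card_pos.1 (by omega)
    obtain ⟨m, hm⟩ := C.exists_maximal hne
    have h1 : ((n : ℕ) : ℕ∞) ≤ Order.height m := by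
      apply ih (C := C.erase m)
      · exact hC.mono (by simp)
      · intro x hx
        rw [Finset.mem_erase] at hx
        rcases hC.total hx.2 hm.1 with h | h
        · exact lt_of_le_of_ne h hx.1
        · exact absurd (le_antisymm (hm.2 hx.2 h) h) hx.1
      · rw [Finset.card_erase_of_mem hm.1]
        omega
    calc ((n + 1 : ℕ) : ℕ∞) = n + 1 := by push_cast; rfl
      _ ≤ Order.height m + 1 := by gcongr
      _ ≤ Order.height F := Order.height_add_one_le (hF m hm.1)

end Height

section Automorphisms

variable {α : Type*} [PartialOrder α]

theorem neg_one_le_faceRank (F : α) : -1 ≤ faceRank F := by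
  unfold faceRank
  omega

theorem Flag.eq_of_subset {A B : Flag α} (h : (A : Set α) ⊆ B) : A = B :=
  Flag.ext (A.max_chain' B.chain_le h)

/-- Being `i`-adjacent is preserved by automorphisms. -/
theorem IAdjacent.image {i : ℤ} {A B : Set α} (h : IAdjacent i A B) (g : α ≃o α) :
    IAdjacent i (g '' A) (g '' B) := by
  refine ⟨fun e => h.1 (g.injective.image_injective e), fun F hF => ?_⟩
  have h1 : ∀ C : Set α, F ∈ g '' C ↔ g.symm F ∈ C := by
    intro C
    constructor
    · rintro ⟨x, hx, rfl⟩
      simpa using hx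
    · intro hx
      exact ⟨_, hx, by simp⟩
  rw [h1, h1]
  exact h.2 _ (by rwa [faceRank_orderIso])

end Automorphisms

namespace IsIncidenceComplexWith

variable {α : Type*} [PartialOrder α] {k : ℕ} {c : ℕ → ℕ} (h : IsIncidenceComplexWith α k c)
include h

theorem exists_flag {C : Set α} (hC : IsChain (· ≤ ·) C) : ∃ Φ : Flag α, C ⊆ Φ :=
  let ⟨Φ, hΦ, _⟩ := h.chain_subset_flag C hC
  ⟨Φ, hΦ⟩

theorem exists_mem_flag (F : α) : ∃ Φ : Flag α, F ∈ Φ := by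
  obtain ⟨Φ, hΦ⟩ := h.exists_flag (C := {F}) IsChain.singleton
  exact ⟨Φ, hΦ rfl⟩

theorem encard_flag (Φ : Flag α) : (Φ : Set α).encard = k + 2 := by
  obtain ⟨Ψ, hΨ, hcard⟩ := h.chain_subset_flag Φ Φ.chain_le
  rw [Flag.eq_of_subset hΨ, hcard]

theorem finite_flag (Φ : Flag α) : (Φ : Set α).Finite := by
  apply Set.finite_of_encard_eq_coe (k := k + 2)
  rw [h.encard_flag]
  rfl

theorem encard_chain_le {C : Set α} (hC : IsChain (· ≤ ·) C) : C.encard ≤ k + 2 := by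
  obtain ⟨Φ, hΦ, hcard⟩ := h.chain_subset_flag C hC
  rw [← hcard]
  exact Set.encard_le_encard hΦ

/-- A longest chain ending in a face of a flag can be taken inside the flag, because its union
with the part of the flag above the face is again a chain. -/
theorem height_eq {Φ : Flag α} {F : α} (hF : F ∈ Φ) :
    Order.height F = ((Φ : Set α) ∩ Set.Iio F).encard := by
  classical
  apply le_antisymm
  · apply Order.height_le
    intro p hp
    have hchain : IsChain (· ≤ ·) (Set.range p ∪ ((Φ : Set α) ∩ Set.Ioi F)) := by
      rw [isChain_union]
      refine ⟨p.strictMono.monotone.isChain_range, Φ.chain_le.mono Set.inter_subset_left, ?_⟩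
      rintro _ ⟨i, rfl⟩ y ⟨_, hy⟩ _
      left
      exact ((p.strictMono.monotone (Fin.le_last i)).trans hp.le).trans (le_of_lt hy)
    have hdisj : Disjoint (Set.range p) ((Φ : Set α) ∩ Set.Ioi F) := by
      rw [Set.disjoint_left]
      rintro _ ⟨i, rfl⟩ ⟨_, hy⟩
      exact absurd ((p.strictMono.monotone (Fin.le_last i)).trans hp.le) (not_le_of_gt hy)
    have h1 := h.encard_chain_le hchain
    have hsplit : (Φ : Set α) =
        insert F (((Φ : Set α) ∩ Set.Iio F) ∪ ((Φ : Set α) ∩ Set.Ioi F)) := by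
      ext x
      simp only [Set.mem_insert_iff, Set.mem_union, Set.mem_inter_iff, Set.mem_Iio, Set.mem_Ioi]
      constructor
      · intro hx
        rcases Φ.le_or_le hx hF with hle | hle
        · rcases hle.eq_or_lt with e | hlt
          · exact Or.inl e
          · exact Or.inr (Or.inl ⟨hx, hlt⟩)
        · rcases hle.eq_or_lt with e | hlt
          · exact Or.inl e.symm
          · exact Or.inr (Or.inr ⟨hx, hlt⟩)
      · rintro (rfl | ⟨hx, _⟩ | ⟨hx, _⟩)
        exacts [hF, hx, hx]
    have h2 := h.encard_flag Φ
    have hdisj2 : Disjoint ((Φ : Set α) ∩ Set.Iio F) ((Φ : Set α) ∩ Set.Ioi F) := by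
      rw [Set.disjoint_left]
      rintro x ⟨_, hx⟩ ⟨_, hy⟩
      exact lt_asymm hx hy
    rw [hsplit, Set.encard_insert_of_notMem (by simp), Set.encard_union_eq hdisj2] at h2
    have hr : (Set.range p).encard = p.length + 1 := by
      rw [← Set.image_univ, p.strictMono.injective.encard_image, Set.encard_univ]
      simp
    rw [Set.encard_union_eq hdisj, ← h2, hr, add_right_comm] at h1
    have hfin : ((Φ : Set α) ∩ Set.Ioi F).encard ≠ ⊤ :=
      ((h.finite_flag Φ).subset Set.inter_subset_left).encard_lt_top.ne
    have h3 := (ENat.add_le_add_iff_right (by simp)).1 h1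
    exact (ENat.add_le_add_iff_right hfin).1 h3
  · have hfin := (h.finite_flag Φ).subset (Set.inter_subset_left (t := Set.Iio F))
    rw [hfin.encard_eq_coe_toFinset_card]
    apply card_le_height_of_isChain
    · rw [hfin.coe_toFinset]
      exact Φ.chain_le.mono Set.inter_subset_left
    · intro x hx
      rw [Set.Finite.mem_toFinset] at hx
      exact hx.2

theorem faceRank_eq {Φ : Flag α} {F : α} (hF : F ∈ Φ) :
    faceRank F = (((Φ : Set α) ∩ Set.Iio F).ncard : ℤ) - 1 := by
  rw [faceRank, h.height_eq hF]
  rfl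

theorem faceRank_lt {F G : α} (hlt : F < G) : faceRank F < faceRank G := by
  obtain ⟨Φ, hΦ⟩ := h.exists_flag (IsChain.pair (r := (· ≤ ·)) hlt.le)
  have hF : F ∈ Φ := hΦ (by simp)
  have hG : G ∈ Φ := hΦ (by simp)
  rw [h.faceRank_eq hF, h.faceRank_eq hG]
  have : ((Φ : Set α) ∩ Set.Iio F).ncard < ((Φ : Set α) ∩ Set.Iio G).ncard := by
    apply Set.ncard_lt_ncard _ ((h.finite_flag Φ).subset Set.inter_subset_left)
    rw [Set.ssubset_iff_of_subset
      (Set.inter_subset_inter_right _ (Set.Iio_subset_Iio hlt.le))]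
    exact ⟨F, ⟨hF, hlt⟩, fun hx => lt_irrefl _ hx.2⟩
  omega

theorem faceRank_le (F : α) : faceRank F ≤ k := by
  obtain ⟨Φ, hF⟩ := h.exists_mem_flag F
  rw [h.faceRank_eq hF]
  have h1 : ((Φ : Set α) ∩ Set.Iio F).ncard < (Φ : Set α).ncard := by
    apply Set.ncard_lt_ncard _ (h.finite_flag Φ)
    rw [Set.ssubset_iff_of_subset Set.inter_subset_left]
    exact ⟨F, hF, fun hx => lt_irrefl _ hx.2⟩
  have h2 : (Φ : Set α).ncard = k + 2 := by
    rw [Set.ncard, h.encard_flag]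
    rfl
  omega

theorem faceRank_mono {F G : α} (hle : F ≤ G) : faceRank F ≤ faceRank G := by
  rcases hle.eq_or_lt with rfl | hlt
  · rfl
  · exact (h.faceRank_lt hlt).le

theorem eq_of_faceRank_eq {C : Set α} (hC : IsChain (· ≤ ·) C) {F G : α} (hF : F ∈ C) (hG : G ∈ C)
    (hr : faceRank F = faceRank G) : F = G := by
  rcases hC.total hF hG with hle | hle
  · by_contra hne
    exact absurd hr (h.faceRank_lt (lt_of_le_of_ne hle hne)).ne
  · by_contra hne
    exact absurd hr (h.faceRank_lt (lt_of_le_of_ne hle (Ne.symm hne))).ne'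

theorem lt_of_faceRank_lt {C : Set α} (hC : IsChain (· ≤ ·) C) {F G : α} (hF : F ∈ C) (hG : G ∈ C)
    (hr : faceRank F < faceRank G) : F < G := by
  rcases hC.total hF hG with hle | hle
  · exact lt_of_le_of_ne hle (fun e => hr.ne (congrArg _ e))
  · exact absurd (h.faceRank_mono hle) (not_le.2 hr)

theorem le_of_faceRank_le {C : Set α} (hC : IsChain (· ≤ ·) C) {F G : α} (hF : F ∈ C) (hG : G ∈ C)
    (hr : faceRank F ≤ faceRank G) : F ≤ G := by
  rcases hr.eq_or_lt with e | hlt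
  · exact (h.eq_of_faceRank_eq hC hF hG e).le
  · exact (h.lt_of_faceRank_lt hC hF hG hlt).le

/-- A flag contains a face of each rank. -/
theorem exists_faceRank_eq (Φ : Flag α) {i : ℤ} (h1 : -1 ≤ i) (h2 : i ≤ k) :
    ∃ F ∈ Φ, faceRank F = i := by
  have hinj : Set.InjOn (faceRank : α → ℤ) Φ := fun F hF G hG hr =>
    h.eq_of_faceRank_eq Φ.chain_le hF hG hr
  have hsub : faceRank '' (Φ : Set α) ⊆ Set.Icc (-1 : ℤ) k := by
    rintro _ ⟨F, _, rfl⟩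
    exact ⟨neg_one_le_faceRank F, h.faceRank_le F⟩
  have heq : faceRank '' (Φ : Set α) = Set.Icc (-1 : ℤ) k := by
    apply ((Set.finite_Icc (-1 : ℤ) k).subset hsub).eq_of_subset_of_encard_le hsub
    rw [hinj.encard_image, h.encard_flag, ← Finset.coe_Icc, Set.encard_coe_eq_coe_finsetCard,
      Int.card_Icc, show ((k : ℤ) + 1 - -1).toNat = k + 2 by omega]
    rfl
  have : i ∈ faceRank '' (Φ : Set α) := heq ▸ ⟨h1, h2⟩
  exact this

theorem isBot_of_faceRank_eq {F : α} (hF : faceRank F = -1) : IsBot F := by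
  obtain ⟨O, hO⟩ := h.exists_least
  rcases (hO F).eq_or_lt with e | hlt
  · exact e ▸ hO
  · have := h.faceRank_lt hlt
    have := neg_one_le_faceRank O
    omega

theorem isTop_of_faceRank_eq {F : α} (hF : faceRank F = k) : IsTop F := by
  obtain ⟨O, hO⟩ := h.exists_greatest
  rcases (hO F).eq_or_lt with e | hlt
  · exact e ▸ hO
  · have := h.faceRank_lt hlt
    have := h.faceRank_le O
    omega

theorem eq_of_faceRank_eq_neg_one {F G : α} (hF : faceRank F = -1) (hG : faceRank G = -1) :
    F = G :=
  le_antisymm (h.isBot_of_faceRank_eq hF G) (h.isBot_of_faceRank_eq hG F)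

theorem eq_of_faceRank_eq_top {F G : α} (hF : faceRank F = k) (hG : faceRank G = k) : F = G :=
  le_antisymm (h.isTop_of_faceRank_eq hG F) (h.isTop_of_faceRank_eq hF G)

/-- A chain that contains a face of each rank is a flag. -/
theorem isMaxChain_of_forall_rank {C : Set α} (hC : IsChain (· ≤ ·) C)
    (hr : ∀ i : ℤ, -1 ≤ i → i ≤ k → ∃ F ∈ C, faceRank F = i) : IsMaxChain (· ≤ ·) C := by
  refine ⟨hC, fun D hD hCD => hCD.antisymm fun F hF => ?_⟩
  obtain ⟨G, hG, hGF⟩ := hr (faceRank F) (neg_one_le_faceRank F) (h.faceRank_le F)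
  rwa [h.eq_of_faceRank_eq hD hF (hCD hG) hGF.symm]

/-- Flags that differ in just one face are `i`-adjacent for some proper rank `i`. -/
theorem exists_iAdjacent {A B : Flag α} (hAB : AdjacentSets (A : Set α) B) :
    ∃ i : ℤ, 0 ≤ i ∧ i < k ∧ IAdjacent i (A : Set α) B := by
  obtain ⟨F, hF⟩ := Set.encard_eq_one.1 hAB.1
  obtain ⟨G, hG⟩ := Set.encard_eq_one.1 hAB.2
  have hFA : F ∈ (A : Set α) \ B := hF ▸ rfl
  have hGB : G ∈ (B : Set α) \ A := hG ▸ rfl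
  have hA : ∀ x ∈ A, x ≠ F → x ∈ B := by
    intro x hx hne
    by_contra hxB
    exact hne (show x ∈ ({F} : Set α) from hF ▸ ⟨hx, hxB⟩)
  have hB : ∀ x ∈ B, x ≠ G → x ∈ A := by
    intro x hx hne
    by_contra hxA
    exact hne (show x ∈ ({G} : Set α) from hG ▸ ⟨hx, hxA⟩)
  have hFG : faceRank F = faceRank G := by
    obtain ⟨G', hG', hr⟩ := h.exists_faceRank_eq B (neg_one_le_faceRank F) (h.faceRank_le F)
    by_cases e : G' = G
    · rw [← hr, e]
    · have := h.eq_of_faceRank_eq A.chain_le (hB G' hG' e) hFA.1 hr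
      exact absurd (this ▸ hG') hFA.2
  have hne : F ≠ G := fun e => hFA.2 (e ▸ hGB.1)
  have h1 : faceRank F ≠ -1 := fun e =>
    hne (h.eq_of_faceRank_eq_neg_one e (hFG ▸ e))
  have h2 : faceRank F ≠ k := fun e =>
    hne (h.eq_of_faceRank_eq_top e (hFG ▸ e))
  have h3 := neg_one_le_faceRank F
  have h4 := h.faceRank_le F
  refine ⟨faceRank F, by omega, by omega, fun e => hFA.2 (e ▸ hFA.1), fun x hx => ⟨fun hxA => ?_,
    fun hxB => ?_⟩⟩
  · exact hA x hxA (fun e => hx (by rw [e]))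
  · exact hB x hxB (fun e => hx (by rw [e, hFG]))

theorem not_mem_of_iAdjacent {i : ℤ} {A B : Flag α} (hAB : IAdjacent i (A : Set α) B) {F : α}
    (hF : F ∈ A) (hi : faceRank F = i) : F ∉ B := by
  intro hFB
  apply hAB.1
  rw [Flag.eq_of_subset (A := A) (B := B)]
  intro x hx
  by_cases hxi : faceRank x = i
  · rwa [h.eq_of_faceRank_eq A.chain_le hx hF (hxi.trans hi.symm)]
  · exact (hAB.2 x hxi).1 hx

/-- An automorphism that maps a flag into a flag containing a face fixes this face. -/
theorem map_eq_of_mem {A B : Flag α} {g : α ≃o α} (hg : g '' (A : Set α) = B) {F : α}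
    (hF : F ∈ A) (hFB : F ∈ B) : g F = F := by
  refine h.eq_of_faceRank_eq B.chain_le ?_ hFB (faceRank_orderIso g F)
  rw [← hg]
  exact ⟨F, hF, rfl⟩

/-- In a regular complex, the automorphisms that fix all faces of the base flag with ranks outside
`J` are products of automorphisms each of which changes at most one face of the base flag, of a rank
in `J`. -/
theorem mem_of_forall_fix (hreg : IsFlagTransitive (⊤ : Subgroup (α ≃o α))) (Φ : Flag α)
    {J : Set ℤ} {H : Subgroup (α ≃o α)} (hbase : distinguishedSubgroup Φ (-1) ≤ H)
    (hH : ∀ j ∈ J, 0 ≤ j → j < k → distinguishedSubgroup Φ j ≤ H) {g : α ≃o α}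
    (hg : ∀ F ∈ Φ, faceRank F ∉ J → g F = F) : g ∈ H := by
  have hpath := h.strongly_connected Φ (Flag.map g Φ)
  have hcommon : ∀ F ∈ Φ, faceRank F ∉ J → F ∈ (Φ : Set α) ∩ (Flag.map g Φ : Flag α) :=
    fun F hF hJ => ⟨hF, ⟨F, hF, hg F hF hJ⟩⟩
  have key : ∀ Ψ : Flag α, Relation.ReflTransGen
      (fun A B : Flag α => AdjacentSets (A : Set α) (B : Set α) ∧
        (Φ : Set α) ∩ (Flag.map g Φ : Flag α) ⊆ (A : Set α) ∧
        (Φ : Set α) ∩ (Flag.map g Φ : Flag α) ⊆ (B : Set α)) Φ Ψ →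
      ∃ x ∈ H, x '' (Φ : Set α) = Ψ := by
    intro Ψ hΨ
    induction hΨ with
    | refl => exact ⟨1, H.one_mem, Set.image_id _⟩
    | @tail A B _ hAB ih =>
      obtain ⟨x, hx, hxA⟩ := ih
      obtain ⟨y, -, hy⟩ := hreg Φ B
      obtain ⟨i, hi0, hik, hi⟩ := h.exists_iAdjacent hAB.1
      have hiJ : i ∈ J := by
        by_contra hiJ
        obtain ⟨F, hF, hFi⟩ := h.exists_faceRank_eq Φ (i := i) (by omega) hik.le
        have hFc := hcommon F hF (hFi ▸ hiJ)
        exact h.not_mem_of_iAdjacent hi (hAB.2.1 hFc) hFi (hAB.2.2 hFc)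
      refine ⟨y, ?_, hy⟩
      have hxy : x⁻¹ * y ∈ H := by
        apply hH i hiJ hi0 hik
        intro F hF hFi
        change x.symm (y F) = F
        rw [OrderIso.symm_apply_eq]
        have h1 : x F ∈ A := by
          change x F ∈ (A : Set α)
          rw [← hxA]
          exact ⟨F, hF, rfl⟩
        have h2 : x F ∈ B := (hi.2 _ (by rwa [faceRank_orderIso])).1 h1
        refine h.eq_of_faceRank_eq B.chain_le ?_ h2 ?_
        · rw [← hy]
          exact ⟨F, hF, rfl⟩
        · rw [faceRank_orderIso, faceRank_orderIso]
      have := H.mul_mem hx hxy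
      rwa [mul_inv_cancel_left] at this
  obtain ⟨x, hx, hxg⟩ := key _ hpath
  have hxg' : x⁻¹ * g ∈ H := by
    apply hbase
    intro F hF _
    change x.symm (g F) = F
    rw [OrderIso.symm_apply_eq]
    refine h.eq_of_faceRank_eq (Flag.map g Φ).chain_le ⟨F, hF, rfl⟩ ?_ ?_
    · rw [← hxg]
      exact ⟨F, hF, rfl⟩
    · rw [faceRank_orderIso, faceRank_orderIso]
  have := H.mul_mem hx hxg'
  rwa [mul_inv_cancel_left] at this

/-- In a regular complex, every chain is the image under an automorphism of the faces of the base
flag that have the same ranks. -/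
theorem exists_automorphism (hreg : IsFlagTransitive (⊤ : Subgroup (α ≃o α))) (Φ : Flag α)
    {C : Set α} (hC : IsChain (· ≤ ·) C) :
    ∃ g : α ≃o α, ∀ F ∈ Φ, ∀ G ∈ C, faceRank F = faceRank G → g F = G := by
  obtain ⟨Ψ, hΨ⟩ := h.exists_flag hC
  obtain ⟨g, -, hg⟩ := hreg Φ Ψ
  refine ⟨g, fun F hF G hG hr => ?_⟩
  refine h.eq_of_faceRank_eq Ψ.chain_le ?_ (hΨ hG) ?_
  · rw [← hg]
    exact ⟨F, hF, rfl⟩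
  · rw [faceRank_orderIso, hr]

end IsIncidenceComplexWith

/-! ### Polytopes -/

section Polytope

variable {α : Type*} [PartialOrder α] {d : ℕ}

/-- In a polytope each flag has at most one `i`-adjacent flag. -/
theorem IsIncidenceComplexWith.eq_of_iAdjacent (h : IsIncidenceComplexWith α d fun _ => 2)
    {i : ℤ} (h0 : 0 ≤ i) (hd : i < d) {A B C : Flag α} (hB : IAdjacent i (A : Set α) B)
    (hC : IAdjacent i (A : Set α) C) : B = C := by
  obtain ⟨m, rfl⟩ := Int.eq_ofNat_of_zero_le h0
  obtain ⟨F, hF, hFr⟩ := h.exists_faceRank_eq A (i := (m : ℤ) - 1) (by omega) (by omega)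
  obtain ⟨G, hG, hGr⟩ := h.exists_faceRank_eq A (i := (m : ℤ) + 1) (by omega) (by omega)
  obtain ⟨a, ha, har⟩ := h.exists_faceRank_eq A (i := (m : ℤ)) (by omega) (by omega)
  obtain ⟨b, hb, hbr⟩ := h.exists_faceRank_eq B (i := (m : ℤ)) (by omega) (by omega)
  obtain ⟨c, hc, hcr⟩ := h.exists_faceRank_eq C (i := (m : ℤ)) (by omega) (by omega)
  have hFG : F < G := h.lt_of_faceRank_lt A.chain_le hF hG (by omega)
  have hcard := h.card_between m (by omega) F G hFr hGr hFG
  have mem : ∀ D : Flag α, F ∈ D → G ∈ D → ∀ x ∈ D, faceRank x = m →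
      x ∈ {H : α | faceRank H = m ∧ F < H ∧ H < G} := by
    intro D hFD hGD x hx hr
    exact ⟨hr, h.lt_of_faceRank_lt D.chain_le hFD hx (by omega),
      h.lt_of_faceRank_lt D.chain_le hx hGD (by omega)⟩
  have hab : a ≠ b := fun e => h.not_mem_of_iAdjacent hB ha har (e ▸ hb)
  have hac : a ≠ c := fun e => h.not_mem_of_iAdjacent hC ha har (e ▸ hc)
  have ha' := mem A hF hG a ha har
  have hb' := mem B ((hB.2 F (by omega)).1 hF) ((hB.2 G (by omega)).1 hG) b hb hbr
  have hc' := mem C ((hC.2 F (by omega)).1 hF) ((hC.2 G (by omega)).1 hG) c hc hcr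
  have hbc : b = c := by
    obtain ⟨x, y, -, hxy⟩ := Set.encard_eq_two.1 (by exact_mod_cast hcard)
    rw [hxy] at ha' hb' hc'
    simp only [Set.mem_insert_iff, Set.mem_singleton_iff] at ha' hb' hc'
    grind
  apply Flag.eq_of_subset
  intro x hx
  by_cases hxi : faceRank x = m
  · rw [h.eq_of_faceRank_eq B.chain_le hx hb (hxi.trans hbr.symm), hbc]
    exact hc
  · exact (hC.2 x hxi).1 ((hB.2 x hxi).2 hx)

/-- The automorphism group of a polytope acts freely on the flags. -/
theorem IsIncidenceComplexWith.eq_one_of_fix (h : IsIncidenceComplexWith α d fun _ => 2)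
    {Φ : Flag α} {g : α ≃o α} (hg : g '' (Φ : Set α) = Φ) : g = 1 := by
  have key : ∀ Ψ : Flag α, g '' (Ψ : Set α) = Ψ := by
    intro Ψ
    have hpath := h.strongly_connected Φ Ψ
    generalize (Φ : Set α) ∩ Ψ = S at hpath
    induction hpath with
    | refl => exact hg
    | @tail A B _ hAB ih =>
      obtain ⟨i, h0, hd, hi⟩ := h.exists_iAdjacent hAB.1
      have h1 := hi.image g
      rw [ih] at h1
      exact congrArg (fun D : Flag α => (D : Set α))
        (h.eq_of_iAdjacent h0 hd (B := Flag.map g B) h1 hi)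
  ext F
  obtain ⟨Ψ, hF⟩ := h.exists_mem_flag F
  exact h.map_eq_of_mem (key Ψ) hF hF

theorem IsIncidenceComplexWith.eq_of_image_eq (h : IsIncidenceComplexWith α d fun _ => 2)
    {Φ : Flag α} {g g' : α ≃o α} (hg : g '' (Φ : Set α) = g' '' (Φ : Set α)) : g = g' := by
  have h1 : g'⁻¹ * g = 1 := by
    apply h.eq_one_of_fix (Φ := Φ)
    change (g'.symm ∘ g) '' (Φ : Set α) = Φ
    rw [Set.image_comp, hg, ← Set.image_comp]
    convert Set.image_id (Φ : Set α)
    simp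
  exact (inv_mul_eq_one.1 h1).symm

end Polytope

/-! ### Systems of subgroups and their coset complexes -/

section Permuting

variable {G : Type*} [Group G]

/-- Two subgroups permute, `X Y ⊆ Y X`; passing to inverses, `X Y = Y X`. -/
def Permutes (X Y : Subgroup G) : Prop := ∀ x ∈ X, ∀ y ∈ Y, ∃ y' ∈ Y, ∃ x' ∈ X, x * y = y' * x'

theorem Permutes.symm {X Y : Subgroup G} (h : Permutes X Y) : Permutes Y X := by
  intro y hy x hx
  obtain ⟨y', hy', x', hx', e⟩ := h x⁻¹ (X.inv_mem hx) y⁻¹ (Y.inv_mem hy)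
  refine ⟨x'⁻¹, X.inv_mem hx', y'⁻¹, Y.inv_mem hy', ?_⟩
  rw [← mul_inv_rev, ← e]
  simp

theorem Permutes.refl (X : Subgroup G) : Permutes X X :=
  fun x hx y hy => ⟨x, hx, y, hy, rfl⟩

theorem Permutes.of_commute {X Y : Subgroup G} (h : ∀ x ∈ X, ∀ y ∈ Y, x * y = y * x) :
    Permutes X Y :=
  fun x hx y hy => ⟨y, hy, x, hx, h x hx y hy⟩

theorem Permutes.map {H : Type*} [Group H] {X Y : Subgroup G} (h : Permutes X Y) (f : G →* H) :
    Permutes (X.map f) (Y.map f) := by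
  rintro _ ⟨x, hx, rfl⟩ _ ⟨y, hy, rfl⟩
  obtain ⟨y', hy', x', hx', e⟩ := h x hx y hy
  exact ⟨f y', ⟨y', hy', rfl⟩, f x', ⟨x', hx', rfl⟩, by rw [← map_mul, e, map_mul]⟩

theorem Permutes.biSup_right {X : Subgroup G} {ι : Type*} {s : Set ι} {Y : ι → Subgroup G}
    (h : ∀ i ∈ s, Permutes X (Y i)) : Permutes X (⨆ i ∈ s, Y i) := by
  rw [iSup_subtype']
  intro x hx y hy
  induction hy using Subgroup.iSup_induction' generalizing x with
  | hp i y hy =>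
    obtain ⟨y', hy', x', hx', e⟩ := h i i.2 x hx y hy
    exact ⟨y', Subgroup.mem_iSup_of_mem i hy', x', hx', e⟩
  | h1 => exact ⟨1, Subgroup.one_mem _, x, hx, by simp⟩
  | hmul y₁ y₂ _ _ ih₁ ih₂ =>
    obtain ⟨y₁', hy₁', x₁, hx₁, e₁⟩ := ih₁ x hx
    obtain ⟨y₂', hy₂', x₂, hx₂, e₂⟩ := ih₂ x₁ hx₁
    exact ⟨y₁' * y₂', Subgroup.mul_mem _ hy₁' hy₂', x₂, hx₂, by
      rw [← mul_assoc, e₁, mul_assoc, e₂, mul_assoc]⟩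

theorem Permutes.biSup {ι : Type*} {s t : Set ι} {Y : ι → Subgroup G}
    (h : ∀ i ∈ s, ∀ j ∈ t, Permutes (Y i) (Y j)) : Permutes (⨆ i ∈ s, Y i) (⨆ j ∈ t, Y j) :=
  Permutes.biSup_right fun j hj => (Permutes.biSup_right fun i hi => (h i hi j hj).symm).symm

theorem Permutes.exists_mul_of_mem_sup {X Y : Subgroup G} (h : Permutes X Y) {g : G}
    (hg : g ∈ X ⊔ Y) : ∃ x ∈ X, ∃ y ∈ Y, g = x * y := by
  rw [Subgroup.sup_eq_closure] at hg
  induction hg using Subgroup.closure_induction with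
  | mem g hg =>
    rcases hg with hg | hg
    · exact ⟨g, hg, 1, Y.one_mem, by simp⟩
    · exact ⟨1, X.one_mem, g, hg, by simp⟩
  | one => exact ⟨1, X.one_mem, 1, Y.one_mem, by simp⟩
  | mul a b _ _ iha ihb =>
    obtain ⟨x₁, hx₁, y₁, hy₁, rfl⟩ := iha
    obtain ⟨x₂, hx₂, y₂, hy₂, rfl⟩ := ihb
    obtain ⟨x', hx', y', hy', e⟩ := h.symm y₁ hy₁ x₂ hx₂
    refine ⟨x₁ * x', X.mul_mem hx₁ hx', y' * y₂, Y.mul_mem hy' hy₂, ?_⟩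
    rw [mul_assoc, ← mul_assoc y₁, e]
    simp only [mul_assoc]
  | inv a _ ih =>
    obtain ⟨x, hx, y, hy, rfl⟩ := ih
    obtain ⟨x', hx', y', hy', e⟩ := h.symm y⁻¹ (Y.inv_mem hy) x⁻¹ (X.inv_mem hx)
    exact ⟨x', hx', y', hy', by rw [mul_inv_rev, e]⟩

end Permuting

section System

variable {G : Type*} [Group G]

/-- The subgroup generated by the `R j` with `j ∈ J ∩ {0, …, n - 1}`, together with `R (-1)`. -/
def spannedSubgroup (n : ℤ) (R : ℤ → Subgroup G) (J : Set ℤ) : Subgroup G :=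
  ⨆ j ∈ insert (-1) (J ∩ Set.Ico 0 n), R j

/-- A system of subgroups `R (-1), R 0, …, R n = R (-1)` as it arises from a flag-transitive group
of automorphisms of an incidence complex of rank `n`: `R i` is to be thought of as consisting of
automorphisms that change no face of the base flag except possibly the one of rank `i`, the
condition `intersection` says that the subgroups `corankSubgroup n R i` behave like stabilizers of
the faces of the base flag, and `encard_image` prescribes the number of faces between two faces of
consecutive ranks. -/
structure IsRankedSystem (n : ℤ) (N : ℕ) (R : ℤ → Subgroup G) (c : ℕ → ℕ) : Prop where
  rank_eq : n = N
  ends : R n = R (-1)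
  permutes_base : ∀ i, 0 ≤ i → i < n → Permutes (R (-1)) (R i)
  permutes : ∀ i j, 0 ≤ i → i + 2 ≤ j → j < n → Permutes (R i) (R j)
  generates : spannedSubgroup n R Set.univ = ⊤
  intersection : ∀ (J : Set ℤ) (g : G),
    (∀ i, 0 ≤ i → i < n → i ∉ J → g ∈ corankSubgroup n R i) → g ∈ spannedSubgroup n R J
  two_le : ∀ i, i < N → 2 ≤ c i
  encard_image : ∀ i : ℕ, i < N →
    ((fun s : G => (s : G ⧸ corankSubgroup n R (i : ℤ))) '' (R i : Set G)).encard = c i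

theorem le_spannedSubgroup {n : ℤ} {R : ℤ → Subgroup G} {J : Set ℤ} {i : ℤ}
    (hi : i ∈ insert (-1) (J ∩ Set.Ico 0 n)) : R i ≤ spannedSubgroup n R J :=
  le_biSup R hi

theorem spannedSubgroup_mono {n : ℤ} {R : ℤ → Subgroup G} {J J' : Set ℤ} (h : J ⊆ J') :
    spannedSubgroup n R J ≤ spannedSubgroup n R J' :=
  biSup_mono fun _ hi => Set.insert_subset_insert (Set.inter_subset_inter_left _ h) hi

theorem spannedSubgroup_le {n : ℤ} {R : ℤ → Subgroup G} {J : Set ℤ} {H : Subgroup G}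
    (h : R (-1) ≤ H) (h' : ∀ i ∈ J, 0 ≤ i → i < n → R i ≤ H) : spannedSubgroup n R J ≤ H := by
  refine iSup₂_le fun i hi => ?_
  rcases hi with rfl | ⟨hi, h0, hn⟩
  · exact h
  · exact h' i hi h0 hn

theorem spannedSubgroup_union {n : ℤ} {R : ℤ → Subgroup G} {J J' : Set ℤ} :
    spannedSubgroup n R (J ∪ J') ≤ spannedSubgroup n R J ⊔ spannedSubgroup n R J' := by
  refine spannedSubgroup_le ((le_spannedSubgroup (J := J) (by simp)).trans le_sup_left) ?_
  rintro i (hi | hi) h0 hn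
  · exact (le_spannedSubgroup (Or.inr ⟨hi, h0, hn⟩)).trans le_sup_left
  · exact (le_spannedSubgroup (Or.inr ⟨hi, h0, hn⟩)).trans le_sup_right

namespace IsRankedSystem

variable {n : ℤ} {N : ℕ} {R : ℤ → Subgroup G} {c : ℕ → ℕ} (h : IsRankedSystem n N R c)
include h

theorem corankSubgroup_eq {i : ℤ} (hi : i ∈ Set.Icc (-1) n) :
    corankSubgroup n R i = spannedSubgroup n R {i}ᶜ := by
  have hn := h.rank_eq
  apply le_antisymm
  · refine iSup₂_le fun j hj => ?_
    by_cases hj' : j = -1 ∨ j = n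
    · have : R j = R (-1) := by
        rcases hj' with rfl | rfl
        · rfl
        · exact h.ends
      rw [this]
      exact le_spannedSubgroup (by simp)
    · push Not at hj'
      obtain ⟨⟨h1, h2⟩, h3⟩ := hj
      exact le_spannedSubgroup (Or.inr ⟨h3, by grind, by grind⟩)
  · refine spannedSubgroup_le ?_ fun j hj h0 hjn => ?_
    · by_cases e : i = -1
      · rw [← h.ends]
        exact le_biSup R (show n ∈ Set.Icc (-1) n \ {i} from ⟨⟨by omega, le_rfl⟩, by grind⟩)
      · exact le_biSup R (show -1 ∈ Set.Icc (-1) n \ {i} from ⟨⟨le_rfl, by omega⟩, by grind⟩)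
    · exact le_biSup R (show j ∈ Set.Icc (-1) n \ {i} from ⟨⟨by omega, hjn.le⟩, hj⟩)

theorem spannedSubgroup_le_corankSubgroup {i : ℤ} (hi : i ∈ Set.Icc (-1) n) {J : Set ℤ}
    (hJ : i ∉ J) : spannedSubgroup n R J ≤ corankSubgroup n R i := by
  rw [h.corankSubgroup_eq hi]
  exact spannedSubgroup_mono (by simpa using hJ)

/-- An element of `corankSubgroup n R i` factorizes into parts which involve only the subgroups with
indices above, respectively below, `i`. -/
theorem exists_factorization {i : ℤ} (hi : i ∈ Set.Icc (-1) n) {g : G}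
    (hg : g ∈ corankSubgroup n R i) :
    ∃ x ∈ spannedSubgroup n R (Set.Ioi i), ∃ y ∈ spannedSubgroup n R (Set.Iio i), g = x * y := by
  have hperm : Permutes (spannedSubgroup n R (Set.Ioi i)) (spannedSubgroup n R (Set.Iio i)) := by
    apply Permutes.biSup
    rintro a (rfl | ⟨ha, ha0, han⟩) b (rfl | ⟨hb, hb0, hbn⟩)
    · exact Permutes.refl _
    · exact h.permutes_base b hb0 hbn
    · exact (h.permutes_base a ha0 han).symm
    · have ha' : i < a := ha
      have hb' : b < i := hb
      exact (h.permutes b a hb0 (by omega) han).symm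
  apply hperm.exists_mul_of_mem_sup
  rw [h.corankSubgroup_eq hi, ← Set.Iio_union_Ioi, Set.union_comm] at hg
  exact spannedSubgroup_union hg

theorem exists_mul_of_mem_singleton {i : ℤ} {g : G} (h0 : 0 ≤ i) (hi : i < n)
    (hg : g ∈ spannedSubgroup n R {i}) : ∃ s ∈ R i, ∃ b ∈ R (-1), g = s * b := by
  apply (h.permutes_base i h0 hi).symm.exists_mul_of_mem_sup
  refine (spannedSubgroup_le le_sup_right ?_ : spannedSubgroup n R {i} ≤ R i ⊔ R (-1)) hg
  rintro _ rfl _ _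
  exact le_sup_left

end IsRankedSystem

namespace CosetFace

variable {n : ℤ} {R : ℤ → Subgroup G}

/-- The coset `g Γ_i`, as a face of rank `i`. -/
def mk (i : Set.Icc (-1 : ℤ) n) (g : G) : CosetFace n R := ⟨i, (g : G ⧸ corankSubgroup n R i)⟩

theorem exists_eq_mk (x : CosetFace n R) : ∃ g, x = mk x.1 g := by
  obtain ⟨i, x⟩ := x
  induction x using QuotientGroup.induction_on with
  | H g => exact ⟨g, rfl⟩

theorem mk_eq_mk_iff {i : Set.Icc (-1 : ℤ) n} {g g' : G} :
    (mk i g : CosetFace n R) = mk i g' ↔ g⁻¹ * g' ∈ corankSubgroup n R i := by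
  change (⟨i, g⟩ : Σ i : Set.Icc (-1 : ℤ) n, G ⧸ corankSubgroup n R i) = ⟨i, g'⟩ ↔ _
  rw [Sigma.mk.injEq, ← QuotientGroup.eq]
  simp

theorem mk_mul_of_mem {i : Set.Icc (-1 : ℤ) n} {g u : G} (hu : u ∈ corankSubgroup n R i) :
    (mk i (g * u) : CosetFace n R) = mk i g := by
  rw [eq_comm, mk_eq_mk_iff]
  simpa using hu

theorem translate_mk (g : G) (i : Set.Icc (-1 : ℤ) n) (g' : G) :
    translate g (mk i g' : CosetFace n R) = mk i (g * g') := rfl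

theorem translate_one (x : CosetFace n R) : translate 1 x = x := by
  obtain ⟨g, hg⟩ := x.exists_eq_mk
  rw [hg, translate_mk, one_mul]

theorem translate_mul (a b : G) (x : CosetFace n R) :
    translate (a * b) x = translate a (translate b x) := by
  obtain ⟨g, hg⟩ := x.exists_eq_mk
  rw [hg, translate_mk, translate_mk, translate_mk, mul_assoc]

theorem le_iff {x y : CosetFace n R} : x.Le y ↔ x.1 ≤ y.1 ∧ ∃ g, x = mk x.1 g ∧ y = mk y.1 g := by
  have key : ∀ (z : CosetFace n R) (g : G),
      z = mk z.1 g ↔ (g : G ⧸ corankSubgroup n R z.1) = z.2 := by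
    rintro ⟨i, z⟩ g
    change (⟨i, z⟩ : Σ i : Set.Icc (-1 : ℤ) n, G ⧸ corankSubgroup n R i) = ⟨i, g⟩ ↔ _
    rw [Sigma.mk.injEq]
    simp only [heq_eq_eq, true_and]
    exact eq_comm
  simp only [key]
  rfl

theorem Le.translate {x y : CosetFace n R} (hxy : x.Le y) (g : G) :
    (x.translate g).Le (y.translate g) := by
  obtain ⟨h1, a, ha, hb⟩ := le_iff.1 hxy
  refine le_iff.2 ⟨h1, g * a, ?_, ?_⟩
  · conv_lhs => rw [ha, translate_mk]
    rfl
  · conv_lhs => rw [hb, translate_mk]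
    rfl

theorem mk_le_mk {i j : Set.Icc (-1 : ℤ) n} (hij : i ≤ j) (g : G) :
    (mk i g : CosetFace n R).Le (mk j g) := le_iff.2 ⟨hij, g, rfl, rfl⟩

end CosetFace

namespace IsRankedSystem

variable {n : ℤ} {N : ℕ} {R : ℤ → Subgroup G} {c : ℕ → ℕ} (h : IsRankedSystem n N R c)
include h

open CosetFace

/-- A representative of a coset can be changed into one of a larger face without changing the
smaller faces that it represents. -/
theorem exists_extend {x y : CosetFace n R} (hxy : x.Le y) {g : G} (hg : x = CosetFace.mk x.1 g) :
    ∃ u ∈ spannedSubgroup n R (Set.Ioi x.1), y = CosetFace.mk y.1 (g * u) := by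
  obtain ⟨hle, g₀, hx, hy⟩ := le_iff.1 hxy
  have hmem : g⁻¹ * g₀ ∈ corankSubgroup n R x.1 := mk_eq_mk_iff.1 (hg.symm.trans hx)
  obtain ⟨u, hu, v, hv, e⟩ := h.exists_factorization x.1.2 hmem
  refine ⟨u, hu, ?_⟩
  have hv' : v ∈ corankSubgroup n R y.1 := h.spannedSubgroup_le_corankSubgroup y.1.2 (J := Set.Iio x.1)
    (not_lt.2 hle) hv
  rw [← mk_mul_of_mem (g := g * u) hv', mul_assoc, ← e, mul_inv_cancel_left]
  exact hy

theorem mem_corankSubgroup_of_le {i j : Set.Icc (-1 : ℤ) n} (hij : i ≤ j) {u : G}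
    (hu : u ∈ spannedSubgroup n R (Set.Ioi j)) : u ∈ corankSubgroup n R i :=
  h.spannedSubgroup_le_corankSubgroup i.2 (J := Set.Ioi (j : ℤ)) (not_lt.2 hij) hu

theorem le_trans {x y z : CosetFace n R} (hxy : x.Le y) (hyz : y.Le z) : x.Le z := by
  obtain ⟨hle, g, hx, hy⟩ := le_iff.1 hxy
  obtain ⟨u, hu, hz⟩ := h.exists_extend hyz hy
  refine le_iff.2 ⟨hle.trans hyz.1, g * u, ?_, hz⟩
  rw [mk_mul_of_mem (h.mem_corankSubgroup_of_le hle hu)]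
  exact hx

/-- The partial order on the faces. -/
abbrev partialOrder : PartialOrder (CosetFace n R) where
  le := CosetFace.Le
  le_refl x := by
    obtain ⟨g, hg⟩ := x.exists_eq_mk
    exact le_iff.2 ⟨le_rfl, g, hg, hg⟩
  le_trans _ _ _ := h.le_trans
  le_antisymm x y hxy hyx := by
    obtain ⟨hle, g, hx, hy⟩ := le_iff.1 hxy
    have := le_antisymm hle hyx.1
    rw [hx, hy, this]

end IsRankedSystem

namespace CosetFace

variable {n : ℤ} {R : ℤ → Subgroup G}

/-- The set of all faces that contain `g`. -/
def flagSet (n : ℤ) (R : ℤ → Subgroup G) (g : G) : Set (CosetFace n R) :=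
  Set.range fun i => mk i g

theorem mk_rank_injective (g : G) : Function.Injective fun i => (mk i g : CosetFace n R) :=
  fun _ _ hij => congrArg Sigma.fst hij

theorem mem_flagSet {g : G} {x : CosetFace n R} : x ∈ flagSet n R g ↔ x = mk x.1 g := by
  constructor
  · rintro ⟨i, rfl⟩
    rfl
  · intro hx
    exact ⟨x.1, hx.symm⟩

theorem translate_image_flagSet (a g : G) :
    translate a '' flagSet n R g = flagSet n R (a * g) := by
  rw [flagSet, ← Set.range_comp]
  rfl

theorem encard_flagSet {N : ℕ} (hn : n = N) (g : G) : (flagSet n R g).encard = N + 2 := by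
  rw [flagSet, ← Set.image_univ, (mk_rank_injective g).encard_image, Set.encard_univ,
    ← Set.encard, ← Finset.coe_Icc, Set.encard_coe_eq_coe_finsetCard, Int.card_Icc, hn]
  rw [show ((N : ℤ) + 1 - -1).toNat = N + 2 by omega]
  rfl

variable [PartialOrder (CosetFace n R)] (hle : ∀ x y : CosetFace n R, x ≤ y ↔ x.Le y)
include hle

theorem isChain_flagSet (g : G) : IsChain (· ≤ ·) (flagSet n R g) := by
  rintro _ ⟨i, rfl⟩ _ ⟨j, rfl⟩ _
  rcases le_total i j with hij | hij
  · exact Or.inl ((hle _ _).2 (mk_le_mk hij g))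
  · exact Or.inr ((hle _ _).2 (mk_le_mk hij g))

theorem eq_of_rank_eq {C : Set (CosetFace n R)} (hC : IsChain (· ≤ ·) C) {x y : CosetFace n R}
    (hx : x ∈ C) (hy : y ∈ C) (hxy : x.1 = y.1) : x = y := by
  have key : ∀ x y : CosetFace n R, x.1 = y.1 → x ≤ y → x = y := by
    intro x y hxy hlexy
    obtain ⟨-, g, h1, h2⟩ := le_iff.1 ((hle _ _).1 hlexy)
    rw [h1, h2, hxy]
  rcases hC.total hx hy with hlexy | hlexy
  · exact key x y hxy hlexy
  · exact (key y x hxy.symm hlexy).symm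

theorem rank_lt {x y : CosetFace n R} (hxy : x < y) : x.1 < y.1 := by
  have h1 := ((hle _ _).1 hxy.le).1
  refine lt_of_le_of_ne h1 fun e => hxy.ne ?_
  exact eq_of_rank_eq hle (IsChain.pair (r := (· ≤ ·)) hxy.le) (by simp) (by simp) e

theorem mk_lt_mk {i j : Set.Icc (-1 : ℤ) n} (hij : i < j) (g : G) :
    (mk i g : CosetFace n R) < mk j g :=
  lt_of_le_of_ne ((hle _ _).2 (mk_le_mk hij.le g)) fun e => hij.ne (congrArg Sigma.fst e)

theorem isMaxChain_flagSet (g : G) : IsMaxChain (· ≤ ·) (flagSet n R g) := by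
  refine ⟨isChain_flagSet hle g, fun D hD hsub => hsub.antisymm fun x hx => ?_⟩
  have h1 : (mk x.1 g : CosetFace n R) ∈ D := hsub ⟨x.1, rfl⟩
  rw [eq_of_rank_eq hle hD hx h1 rfl]
  exact ⟨x.1, rfl⟩

theorem faceRank_eq (x : CosetFace n R) : faceRank x = x.1 := by
  classical
  have hmono : StrictMono fun y : CosetFace n R => ((y.1 : ℤ) + 1).toNat := by
    intro a b hab
    have h1 : (a.1 : ℤ) < b.1 := rank_lt hle hab
    have h2 := a.1.2.1
    change ((a.1 : ℤ) + 1).toNat < ((b.1 : ℤ) + 1).toNat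
    omega
  have h1 := Order.height_le_height_apply_of_strictMono _ hmono x
  obtain ⟨g, hg⟩ := x.exists_eq_mk
  have h2 : (((x.1 : ℤ) + 1).toNat : ℕ∞) ≤ Order.height x := by
    have hchain := isChain_flagSet (n := n) (R := R) hle g
    let C : Finset (CosetFace n R) := (Finset.univ.filter fun i => i < x.1).image fun i => CosetFace.mk i g
    have hcard : C.card = ((x.1 : ℤ) + 1).toNat := by
      rw [Finset.card_image_of_injective _ (mk_rank_injective g)]
      have : (Finset.univ.filter fun i => i < x.1).map (Function.Embedding.subtype _) =
          Finset.Ico (-1) (x.1 : ℤ) := by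
        ext i
        simp only [Finset.mem_map, Finset.mem_filter, Finset.mem_univ, true_and,
          Function.Embedding.coe_subtype, Finset.mem_Ico]
        constructor
        · rintro ⟨j, hj, rfl⟩
          exact ⟨j.2.1, hj⟩
        · rintro ⟨ha, hb⟩
          exact ⟨⟨i, ha, hb.le.trans x.1.2.2⟩, hb, rfl⟩
      rw [← Finset.card_map (Function.Embedding.subtype _), this, Int.card_Ico]
      congr 1
    rw [← hcard]
    apply card_le_height_of_isChain
    · refine hchain.mono ?_
      intro y hy
      obtain ⟨i, -, rfl⟩ := Finset.mem_image.1 hy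
      exact ⟨i, rfl⟩
    · intro y hy
      obtain ⟨i, hi, rfl⟩ := Finset.mem_image.1 hy
      have hi' : i < x.1 := (Finset.mem_filter.1 hi).2
      rw [hg]
      exact mk_lt_mk hle hi' g
  have h3 : Order.height x = (((x.1 : ℤ) + 1).toNat : ℕ∞) := by
    apply le_antisymm _ h2
    simpa using h1
  have h4 := x.1.2.1
  rw [faceRank, h3, ENat.toNat_natCast]
  omega

/-- The flag of all faces that contain `g`. -/
def cosetFlag (g : G) : Flag (CosetFace n R) := Flag.ofIsMaxChain _ (isMaxChain_flagSet hle g)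

end CosetFace

namespace IsRankedSystem

open CosetFace

variable {n : ℤ} {N : ℕ} {R : ℤ → Subgroup G} {c : ℕ → ℕ} (h : IsRankedSystem n N R c)
  [PartialOrder (CosetFace n R)] (hle : ∀ x y : CosetFace n R, x ≤ y ↔ x.Le y)
include h hle

/-- The cosets in a chain have an element in common. -/
theorem exists_subset_flagSet {C : Set (CosetFace n R)} (hC : IsChain (· ≤ ·) C) :
    ∃ g, C ⊆ flagSet n R g := by
  have hfin : C.Finite := by
    refine Set.Finite.of_finite_image (f := fun x => x.1) (Set.toFinite _) ?_
    exact fun x hx y hy hxy => eq_of_rank_eq hle hC hx hy hxy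
  induction hm : C.ncard generalizing C with
  | zero =>
    rw [Set.ncard_eq_zero hfin] at hm
    exact ⟨1, by simp [hm]⟩
  | succ m ih =>
    have hne : C.Nonempty := (Set.ncard_pos hfin).1 (by omega)
    obtain ⟨z, hz, hzmax⟩ := Set.exists_max_image C (fun x => x.1) hfin hne
    obtain ⟨g, hg⟩ := ih (C := C \ {z}) (hC.mono Set.sdiff_subset) (hfin.subset Set.sdiff_subset)
      (by rw [Set.ncard_sdiff_singleton_of_mem hz]; omega)
    rcases (C \ {z}).eq_empty_or_nonempty with h0 | hne'
    · obtain ⟨a, ha⟩ := z.exists_eq_mk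
      refine ⟨a, fun x hx => ?_⟩
      have : x = z := by
        by_contra hxz
        have : x ∈ C \ {z} := ⟨hx, hxz⟩
        rw [h0] at this
        exact this
      rw [this, mem_flagSet]
      exact ha
    · obtain ⟨y, hy, hymax⟩ := Set.exists_max_image (C \ {z}) (fun x => x.1)
        (hfin.subset Set.sdiff_subset) hne'
      have hyz : y ≤ z := by
        rcases hC.total hy.1 hz with e | e
        · exact e
        · have := rank_lt hle (lt_of_le_of_ne e (fun e => hy.2 e.symm))
          exact absurd (hzmax y hy.1) (not_le.2 this)
      obtain ⟨u, hu, hzu⟩ := h.exists_extend ((hle _ _).1 hyz) (mem_flagSet.1 (hg hy))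
      refine ⟨g * u, fun x hx => ?_⟩
      rw [mem_flagSet]
      by_cases hxz : x = z
      · rw [hxz]
        exact hzu
      · rw [mk_mul_of_mem (h.mem_corankSubgroup_of_le (hymax x ⟨hx, hxz⟩) hu)]
        exact mem_flagSet.1 (hg ⟨hx, hxz⟩)

theorem exists_eq_cosetFlag (Φ : Flag (CosetFace n R)) : ∃ g, Φ = cosetFlag hle g := by
  obtain ⟨g, hg⟩ := h.exists_subset_flagSet hle Φ.chain_le
  exact ⟨g, Flag.eq_of_subset hg⟩

/-- Neighbouring steps along the generators in `J` join flags that agree outside `J`. -/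
theorem reflTransGen_of_mem {J : Set ℤ} {S : Set (CosetFace n R)} {v : G}
    (hv : v ∈ spannedSubgroup n R J) {g : G} (hS : S ⊆ flagSet n R g)
    (hSJ : ∀ x ∈ S, (x.1 : ℤ) ∉ J) :
    S ⊆ flagSet n R (g * v) ∧ Relation.ReflTransGen
      (fun A B : Flag (CosetFace n R) => AdjacentSets (A : Set (CosetFace n R)) B ∧
        S ⊆ A ∧ S ⊆ B) (cosetFlag hle g) (cosetFlag hle (g * v)) := by
  have hsub : ∀ g v, v ∈ spannedSubgroup n R J → S ⊆ flagSet n R g → S ⊆ flagSet n R (g * v) := by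
    intro g v hv hS x hx
    rw [mem_flagSet, mk_mul_of_mem (h.spannedSubgroup_le_corankSubgroup x.1.2 (hSJ x hx) hv)]
    exact mem_flagSet.1 (hS hx)
  refine ⟨hsub g v hv hS, ?_⟩
  rw [spannedSubgroup, iSup_subtype'] at hv
  induction hv using Subgroup.iSup_induction' generalizing g with
  | h1 => rw [mul_one]
  | hmul a b ha hb iha ihb =>
    replace ha : a ∈ spannedSubgroup n R J := by rwa [spannedSubgroup, iSup_subtype']
    have := ihb (hsub g a ha hS)
    rw [mul_assoc] at this
    exact (iha hS).trans this
  | hp j v hv =>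
    have hagree : ∀ i : Set.Icc (-1) n, (i : ℤ) ≠ j ∨ (j : ℤ) = -1 →
        (CosetFace.mk i (g * v) : CosetFace n R) = CosetFace.mk i g := by
      intro i hi
      apply mk_mul_of_mem
      rw [h.corankSubgroup_eq i.2]
      refine le_spannedSubgroup (i := j) ?_ hv
      rcases j.2 with e | hj
      · exact Or.inl e
      · refine Or.inr ⟨?_, hj.2⟩
        rcases hi with hi | hi
        · exact fun e => hi e.symm
        · have := hj.2.1
          omega
    have heq : ∀ i : Set.Icc (-1) n, (CosetFace.mk i (g * v) : CosetFace n R) = CosetFace.mk i g →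
        (CosetFace.mk i g : CosetFace n R) ∈ flagSet n R (g * v) := fun i hi => ⟨i, hi⟩
    by_cases hall : ∀ i : Set.Icc (-1) n,
        (CosetFace.mk i (g * v) : CosetFace n R) = CosetFace.mk i g
    · have : cosetFlag hle g = cosetFlag hle (g * v) := by
        apply Flag.eq_of_subset
        rintro _ ⟨i, rfl⟩
        exact heq i (hall i)
      rw [this]
    · push Not at hall
      obtain ⟨i, hi⟩ := hall
      have hij : (i : ℤ) = j ∧ (j : ℤ) ≠ -1 := by
        by_contra hcon
        exact hi (hagree i (by tauto))
      have hdiff : ∀ a b : G, (∀ m : Set.Icc (-1) n, m ≠ i →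
          (CosetFace.mk m a : CosetFace n R) = CosetFace.mk m b) →
          (CosetFace.mk i a : CosetFace n R) ≠ CosetFace.mk i b →
          flagSet n R a \ flagSet n R b = {CosetFace.mk i a} := by
        intro a b hab hne
        ext x
        simp only [Set.mem_sdiff, Set.mem_singleton_iff, mem_flagSet]
        constructor
        · rintro ⟨hx1, hx2⟩
          by_cases hxi : x.1 = i
          · rw [hx1, hxi]
          · exact absurd (hx1.trans (hab _ hxi)) hx2
        · rintro rfl
          exact ⟨rfl, hne⟩
      have hm : ∀ m : Set.Icc (-1) n, m ≠ i →
          (CosetFace.mk m (g * v) : CosetFace n R) = CosetFace.mk m g := fun m hm =>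
        hagree m (Or.inl fun e => hm (Subtype.ext (e.trans hij.1.symm)))
      refine Relation.ReflTransGen.single ⟨⟨?_, ?_⟩, hS, ?_⟩
      · change (flagSet n R g \ flagSet n R (g * v)).encard = 1
        rw [hdiff _ _ (fun m h => (hm m h).symm) (Ne.symm hi), Set.encard_singleton]
      · change (flagSet n R (g * v) \ flagSet n R g).encard = 1
        rw [hdiff _ _ hm hi, Set.encard_singleton]
      · exact hsub g v (le_spannedSubgroup j.2 hv) hS

/-- The faces between `g Γ_{i-1}` and `g Γ_{i+1}` are the cosets `g s Γ_i` with `s ∈ R i`. -/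
theorem between_eq {i m j : Set.Icc (-1 : ℤ) n} (him : (i : ℤ) + 1 = m) (hmj : (m : ℤ) + 1 = j)
    (g : G) :
    {x : CosetFace n R | x.1 = m ∧ CosetFace.mk i g < x ∧ x < CosetFace.mk j g} =
      (fun s => (CosetFace.mk m (g * s) : CosetFace n R)) '' (R m : Set G) := by
  have hi := i.2.1
  have hj := j.2.2
  have him' : i < m := by
    change (i : ℤ) < m
    omega
  have hmj' : m < j := by
    change (m : ℤ) < j
    omega
  apply Set.Subset.antisymm
  · rintro x ⟨rfl, hlt1, hlt2⟩
    have hchain : IsChain (· ≤ ·)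
        ({CosetFace.mk i g, x, CosetFace.mk j g} : Set (CosetFace n R)) := by
      refine (IsChain.pair (r := (· ≤ ·)) hlt2.le).insert ?_
      rintro y (rfl | rfl) _
      · exact Or.inl hlt1.le
      · exact Or.inl (hlt1.trans hlt2).le
    obtain ⟨g', hg'⟩ := h.exists_subset_flagSet hle hchain
    have e1 := mem_flagSet.1 (hg' (Set.mem_insert _ _))
    have e2 := mem_flagSet.1 (hg' (Set.mem_insert_of_mem _ (Set.mem_insert _ _)))
    have e3 := mem_flagSet.1 (hg' (Set.mem_insert_of_mem _ (Set.mem_insert_of_mem _ rfl)))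
    have m1 : g⁻¹ * g' ∈ corankSubgroup n R i := mk_eq_mk_iff.1 e1
    have m3 : g⁻¹ * g' ∈ corankSubgroup n R j := mk_eq_mk_iff.1 e3
    -- split off the parts of `g⁻¹ g'` that do not change the coset of rank `m`
    obtain ⟨u, hu, v, hv, e⟩ := h.exists_factorization j.2 (Subgroup.inv_mem _ m3)
    have e' : g' = g * v⁻¹ * u⁻¹ := by
      rw [mul_assoc, ← mul_inv_rev, ← e]
      group
    have hva : v⁻¹ ∈ corankSubgroup n R i := by
      have := Subgroup.mul_mem _ m1 (h.mem_corankSubgroup_of_le (him'.trans hmj').le hu)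
      rw [e'] at this
      simpa [mul_assoc] using this
    have hv' := Subgroup.inv_mem _ hv
    obtain ⟨u', hu', w, hw, e₂⟩ := h.exists_factorization i.2 hva
    have hwm : w ∈ corankSubgroup n R x.1 :=
      h.spannedSubgroup_le_corankSubgroup x.1.2 (J := Set.Iio (i : ℤ)) (not_lt.2 him'.le) hw
    have hx : x = CosetFace.mk x.1 (g * u') := by
      rw [e2, e', mk_mul_of_mem (Subgroup.inv_mem _ (h.mem_corankSubgroup_of_le hmj'.le hu)), e₂,
        ← mul_assoc, mk_mul_of_mem hwm]
      rfl
    have hu'j : u' ∈ spannedSubgroup n R (Set.Iio (j : ℤ)) := by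
      have h1 : u' = v⁻¹ * w⁻¹ := by
        rw [e₂]
        group
      rw [h1]
      refine Subgroup.mul_mem _ hv' (Subgroup.inv_mem _ (spannedSubgroup_mono ?_ hw))
      exact Set.Iio_subset_Iio (him'.trans hmj').le
    have hmem : u' ∈ spannedSubgroup n R {(x.1 : ℤ)} := by
      apply h.intersection
      intro p hp0 hpn hp
      rcases lt_or_gt_of_ne (show p ≠ x.1 from hp) with hlt | hgt
      · exact h.spannedSubgroup_le_corankSubgroup (by grind) (J := Set.Ioi (i : ℤ)) (by grind) hu'
      · exact h.spannedSubgroup_le_corankSubgroup (by grind) (J := Set.Iio (j : ℤ)) (by grind) hu'j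
    obtain ⟨s, hs, b, hb, e₃⟩ := h.exists_mul_of_mem_singleton (by omega) (by omega) hmem
    refine ⟨s, hs, ?_⟩
    have hb' : b ∈ corankSubgroup n R x.1 := by
      rw [h.corankSubgroup_eq x.1.2]
      exact le_spannedSubgroup (Set.mem_insert _ _) hb
    change CosetFace.mk x.1 (g * s) = x
    rw [← mk_mul_of_mem hb', mul_assoc, ← e₃]
    exact hx.symm
  · rintro _ ⟨s, hs, rfl⟩
    have hsub : R m ≤ spannedSubgroup n R {(m : ℤ)} :=
      le_spannedSubgroup (Or.inr ⟨rfl, by grind⟩)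
    have h1 := h.spannedSubgroup_le_corankSubgroup i.2 (J := {(m : ℤ)}) (by grind) (hsub hs)
    have h2 := h.spannedSubgroup_le_corankSubgroup j.2 (J := {(m : ℤ)}) (by grind) (hsub hs)
    refine ⟨rfl, ?_, ?_⟩
    · rw [← mk_mul_of_mem h1]
      exact mk_lt_mk hle him' _
    · rw [← mk_mul_of_mem h2]
      exact mk_lt_mk hle hmj' _

theorem isIncidenceComplexWith : IsIncidenceComplexWith (CosetFace n R) N c where
  exists_least := by
    have hn := h.rank_eq
    have hI : (-1 : ℤ) ∈ Set.Icc (-1) n := by grind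
    refine ⟨CosetFace.mk ⟨-1, hI⟩ 1, fun x => ?_⟩
    obtain ⟨g, hg⟩ := x.exists_eq_mk
    refine (hle _ _).2 (le_iff.2 ⟨x.1.2.1, g, ?_, hg⟩)
    apply mk_eq_mk_iff.2
    rw [h.corankSubgroup_eq hI]
    refine spannedSubgroup_le ?_ ?_ (h.generates ▸ Subgroup.mem_top _ :
      1⁻¹ * g ∈ spannedSubgroup n R Set.univ)
    · exact le_spannedSubgroup (Set.mem_insert _ _)
    · intro i _ h0 hi
      exact le_spannedSubgroup (Or.inr ⟨by grind, h0, hi⟩)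
  exists_greatest := by
    have hn := h.rank_eq
    have hI : n ∈ Set.Icc (-1) n := by grind
    refine ⟨CosetFace.mk ⟨n, hI⟩ 1, fun x => ?_⟩
    obtain ⟨g, hg⟩ := x.exists_eq_mk
    refine (hle _ _).2 (le_iff.2 ⟨x.1.2.2, g, hg, ?_⟩)
    apply mk_eq_mk_iff.2
    rw [h.corankSubgroup_eq hI]
    refine spannedSubgroup_le ?_ ?_ (h.generates ▸ Subgroup.mem_top _ :
      1⁻¹ * g ∈ spannedSubgroup n R Set.univ)
    · exact le_spannedSubgroup (Set.mem_insert _ _)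
    · intro i _ h0 hi
      exact le_spannedSubgroup (Or.inr ⟨by grind, h0, hi⟩)
  chain_subset_flag C hC := by
    obtain ⟨g, hg⟩ := h.exists_subset_flagSet hle hC
    exact ⟨cosetFlag hle g, hg, encard_flagSet h.rank_eq g⟩
  strongly_connected Φ Ψ := by
    obtain ⟨a, rfl⟩ := h.exists_eq_cosetFlag hle Φ
    obtain ⟨b, rfl⟩ := h.exists_eq_cosetFlag hle Ψ
    let J : Set ℤ := {i | ∀ hi : i ∈ Set.Icc (-1) n, a⁻¹ * b ∉ corankSubgroup n R i}
    have hv : a⁻¹ * b ∈ spannedSubgroup n R J := by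
      apply h.intersection
      intro i h0 hi hiJ
      by_contra hcon
      exact hiJ fun _ => hcon
    have := (h.reflTransGen_of_mem hle hv (g := a)
      (S := ((cosetFlag hle a : Flag _) : Set (CosetFace n R)) ∩ cosetFlag hle b)
      Set.inter_subset_left ?_).2
    · rwa [mul_inv_cancel_left] at this
    · rintro x ⟨hxa, hxb⟩ hxJ
      refine hxJ x.1.2 (mk_eq_mk_iff.1 ?_)
      exact (mem_flagSet.1 hxa).symm.trans (mem_flagSet.1 hxb)
  two_le := h.two_le
  card_between i hi F F' hF hF' hFF' := by
    have hn := h.rank_eq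
    rw [CosetFace.faceRank_eq hle] at hF hF'
    obtain ⟨g, hg⟩ := h.exists_subset_flagSet hle (IsChain.pair (r := (· ≤ ·)) hFF'.le)
    have hFg := mem_flagSet.1 (hg (Set.mem_insert _ _))
    have hFg' := mem_flagSet.1 (hg (Set.mem_insert_of_mem _ rfl))
    have hI : (i : ℤ) ∈ Set.Icc (-1) n := by grind
    have key := h.between_eq hle (i := F.1) (m := ⟨i, hI⟩) (j := F'.1)
      (show (F.1 : ℤ) + 1 = i by omega) (show (i : ℤ) + 1 = F'.1 by omega) g
    rw [← hFg, ← hFg'] at key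
    have hset : {H : CosetFace n R | faceRank H = i ∧ F < H ∧ H < F'} =
        {x : CosetFace n R | x.1 = ⟨i, hI⟩ ∧ F < x ∧ x < F'} := by
      ext x
      change faceRank x = i ∧ _ ↔ x.1 = ⟨i, hI⟩ ∧ _
      rw [CosetFace.faceRank_eq hle, Subtype.ext_iff]
    let f : G ⧸ corankSubgroup n R (i : ℤ) → CosetFace n R := fun y => ⟨⟨i, hI⟩, g • y⟩
    have himage : (fun s => (CosetFace.mk ⟨i, hI⟩ (g * s) : CosetFace n R)) '' (R i : Set G) =
        f '' ((fun s : G => (s : G ⧸ corankSubgroup n R (i : ℤ))) '' (R i : Set G)) := by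
      rw [Set.image_image]
      rfl
    have hinj : Function.Injective f := by
      intro y z hyz
      have : g • y = g • z := eq_of_heq (Sigma.mk.inj hyz).2
      exact MulAction.injective g this
    rw [hset, key, himage]
    exact (hinj.encard_image _).trans (h.encard_image i hi)

omit h in
/-- The action of the group on the faces by translation. -/
def translationHom : G →* (CosetFace n R ≃o CosetFace n R) where
  toFun g :=
    { toFun := translate g
      invFun := translate g⁻¹
      left_inv := fun x => by rw [← translate_mul, inv_mul_cancel, translate_one]
      right_inv := fun x => by rw [← translate_mul, mul_inv_cancel, translate_one]
      map_rel_iff' := by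
        intro x y
        change translate g x ≤ translate g y ↔ x ≤ y
        rw [hle, hle]
        refine ⟨fun hxy => ?_, fun hxy => hxy.translate g⟩
        have := hxy.translate g⁻¹
        rwa [← translate_mul, ← translate_mul, inv_mul_cancel, translate_one, translate_one]
          at this }
  map_one' := by
    ext x
    exact translate_one x
  map_mul' a b := by
    ext x
    exact translate_mul a b x

omit h in
theorem translationHom_apply (g : G) (x : CosetFace n R) :
    translationHom hle g x = translate g x := rfl

theorem isFlagTransitive_range : IsFlagTransitive (translationHom hle).range := by
  intro Φ Ψ
  obtain ⟨a, rfl⟩ := h.exists_eq_cosetFlag hle Φ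
  obtain ⟨b, rfl⟩ := h.exists_eq_cosetFlag hle Ψ
  refine ⟨translationHom hle (b * a⁻¹), ⟨_, rfl⟩, ?_⟩
  change translate (b * a⁻¹) '' flagSet n R a = flagSet n R b
  rw [translate_image_flagSet, inv_mul_cancel_right]

theorem isFlagTransitive_top :
    IsFlagTransitive (⊤ : Subgroup (CosetFace n R ≃o CosetFace n R)) := by
  intro Φ Ψ
  obtain ⟨g, -, hg⟩ := h.isFlagTransitive_range hle Φ Ψ
  exact ⟨g, Subgroup.mem_top g, hg⟩

omit hle [PartialOrder (CosetFace n R)] in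
/-- The stabilizer of a flag in `G` is a conjugate of `R (-1)`. -/
theorem mem_of_translate_flagSet {a g : G} (hg : flagSet n R (g * a) = flagSet n R a) :
    a⁻¹ * g * a ∈ R (-1) := by
  have h1 : a⁻¹ * g * a ∈ spannedSubgroup n R ∅ := by
    apply h.intersection
    intro i h0 hi _
    have hI : i ∈ Set.Icc (-1) n := ⟨by omega, hi.le⟩
    have h2 : (CosetFace.mk ⟨i, hI⟩ (g * a) : CosetFace n R) ∈ flagSet n R a :=
      hg ▸ ⟨_, rfl⟩
    have h3 : (CosetFace.mk ⟨i, hI⟩ (g * a) : CosetFace n R) = CosetFace.mk ⟨i, hI⟩ a :=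
      mem_flagSet.1 h2
    have h4 := mk_eq_mk_iff.1 h3.symm
    rwa [← mul_assoc] at h4
  exact (spannedSubgroup_le le_rfl (by simp) : spannedSubgroup n R ∅ ≤ R (-1)) h1

theorem conj_mem_of_translationHom_eq_one {g : G} (hg : translationHom hle g = 1) (a : G) :
    a⁻¹ * g * a ∈ R (-1) := by
  apply h.mem_of_translate_flagSet
  rw [← translate_image_flagSet]
  have : translate g = (id : CosetFace n R → CosetFace n R) := by
    funext x
    rw [← translationHom_apply hle, hg]
    rfl
  rw [this, Set.image_id]

end IsRankedSystem

end System

/-! ### Distinguished subgroups of regular complexes and polytopes -/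

section Distinguished

variable {α : Type*} [PartialOrder α]

/-- Distinguished subgroups with non-neighbouring indices permute: after `g ∈ R_a` and `h ∈ R_b`,
the faces of the base flag of ranks other than `b` and the image of the one of rank `b` still form a
chain. -/
theorem IsIncidenceComplexWith.permutes_distinguishedSubgroup {k : ℕ} {c : ℕ → ℕ}
    (h : IsIncidenceComplexWith α k c) (hreg : IsFlagTransitive (⊤ : Subgroup (α ≃o α)))
    (Φ : Flag α) {a b : ℤ} (ha : 0 ≤ a) (hab : a + 2 ≤ b) (hb : b < k) :
    Permutes (distinguishedSubgroup Φ a) (distinguishedSubgroup Φ b) := by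
  intro x hx y hy
  obtain ⟨F₁, hF₁, hr₁⟩ := h.exists_faceRank_eq Φ (i := b - 1) (by omega) (by omega)
  obtain ⟨F₂, hF₂, hr₂⟩ := h.exists_faceRank_eq Φ (i := b + 1) (by omega) (by omega)
  obtain ⟨F, hF, hr⟩ := h.exists_faceRank_eq Φ (i := b) (by omega) (by omega)
  have hfix : ∀ G ∈ Φ, faceRank G ≠ a → faceRank G ≠ b → x (y G) = G := by
    intro G hG h1 h2
    rw [hy G hG h2, hx G hG h1]
  have hchain : IsChain (· ≤ ·) (insert (x (y F)) {G | G ∈ Φ ∧ faceRank G ≠ b}) := by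
    refine (Φ.chain_le.mono fun G hG => hG.1).insert ?_
    rintro G ⟨hG, hGb⟩ _
    rcases lt_or_gt_of_ne hGb with hlt | hgt
    · right
      have h1 : G ≤ F₁ := h.le_of_faceRank_le Φ.chain_le hG hF₁ (by omega)
      have h2 : F₁ ≤ F := h.le_of_faceRank_le Φ.chain_le hF₁ hF (by omega)
      calc G ≤ F₁ := h1
        _ = x (y F₁) := (hfix F₁ hF₁ (by omega) (by omega)).symm
        _ ≤ x (y F) := x.monotone (y.monotone h2)
    · left
      have h1 : F₂ ≤ G := h.le_of_faceRank_le Φ.chain_le hF₂ hG (by omega)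
      have h2 : F ≤ F₂ := h.le_of_faceRank_le Φ.chain_le hF hF₂ (by omega)
      calc x (y F) ≤ x (y F₂) := x.monotone (y.monotone h2)
        _ = F₂ := hfix F₂ hF₂ (by omega) (by omega)
        _ ≤ G := h1
  obtain ⟨z, hz⟩ := h.exists_automorphism hreg Φ hchain
  have hzF : z F = x (y F) :=
    hz F hF _ (Set.mem_insert _ _) (by rw [faceRank_orderIso, faceRank_orderIso])
  have hzG : ∀ G ∈ Φ, faceRank G ≠ b → z G = G := fun G hG hGb =>
    hz G hG G (Set.mem_insert_of_mem _ ⟨hG, hGb⟩) rfl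
  refine ⟨z, hzG, z⁻¹ * (x * y), ?_, by rw [mul_inv_cancel_left]⟩
  intro G hG hGa
  change z.symm (x (y G)) = G
  rw [OrderIso.symm_apply_eq]
  by_cases hGb : faceRank G = b
  · rw [h.eq_of_faceRank_eq Φ.chain_le hG hF (hGb.trans hr.symm), hzF]
  · rw [hfix G hG hGa hGb, hzG G hG hGb]

theorem distinguishedSubgroup_neg_one_le {Φ : Flag α} {i : ℤ} {k : ℕ} {c : ℕ → ℕ}
    (h : IsIncidenceComplexWith α k c) :
    distinguishedSubgroup Φ (-1) ≤ distinguishedSubgroup Φ i := by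
  intro g hg F hF _
  by_cases hr : faceRank F = -1
  · exact h.eq_of_faceRank_eq_neg_one (by rwa [faceRank_orderIso]) hr
  · exact hg F hF hr

variable {d : ℕ} {Φ : Flag α} {ρ : Fin d → (α ≃o α)}

theorem IsDistinguished.mem (hd : IsIncidenceComplexWith α d fun _ => 2)
    (hρ : IsDistinguished Φ ρ) (i : Fin d) : ρ i ∈ distinguishedSubgroup Φ i := by
  intro F hF hi
  exact hd.map_eq_of_mem (A := Φ) (B := Flag.map (ρ i) Φ) rfl hF (((hρ i).2 F hi).1 hF)

theorem IsDistinguished.apply_ne (hd : IsIncidenceComplexWith α d fun _ => 2)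
    (hρ : IsDistinguished Φ ρ) {i : Fin d} {F : α} (hF : F ∈ Φ) (hr : faceRank F = i) :
    ρ i F ≠ F := fun e =>
  hd.not_mem_of_iAdjacent (B := Flag.map (ρ i) Φ) (hρ i) hF hr ⟨F, hF, e⟩

theorem IsDistinguished.eq_one_or_eq (hd : IsIncidenceComplexWith α d fun _ => 2)
    (hρ : IsDistinguished Φ ρ) {i : Fin d} {g : α ≃o α} (hg : g ∈ distinguishedSubgroup Φ i) :
    g = 1 ∨ g = ρ i := by
  by_cases hfix : g '' (Φ : Set α) = Φ
  · exact Or.inl (hd.eq_one_of_fix hfix)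
  · right
    apply hd.eq_of_image_eq (Φ := Φ)
    have hadj : IAdjacent (i : ℤ) (Φ : Set α) (Flag.map g Φ : Flag α) := by
      refine ⟨fun e => hfix e.symm, fun F hF => ⟨fun hFΦ => ⟨F, hFΦ, hg F hFΦ hF⟩, ?_⟩⟩
      rintro ⟨G, hG, rfl⟩
      rw [faceRank_orderIso] at hF
      rw [hg G hG hF]
      exact hG
    exact congrArg (fun D : Flag α => (D : Set α)) (hd.eq_of_iAdjacent (by omega) (by omega)
      (B := Flag.map g Φ) (C := Flag.map (ρ i) Φ) hadj (hρ i))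

theorem IAdjacent.symm {i : ℤ} {A B : Set α} (h : IAdjacent i A B) : IAdjacent i B A :=
  ⟨h.1.symm, fun F hF => (h.2 F hF).symm⟩

theorem IsDistinguished.mul_self (hd : IsIncidenceComplexWith α d fun _ => 2)
    (hρ : IsDistinguished Φ ρ) (i : Fin d) : ρ i * ρ i = 1 := by
  apply hd.eq_one_of_fix (Φ := Φ)
  have h1 : IAdjacent (i : ℤ) ((Flag.map (ρ i) Φ : Flag α) : Set α)
      (Flag.map (ρ i) (Flag.map (ρ i) Φ) : Flag α) := (hρ i).image (ρ i)
  have h2 := hd.eq_of_iAdjacent (by omega) (by omega) h1 (hρ i).symm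
  rw [show (⇑(ρ i * ρ i)) = ρ i ∘ ρ i from rfl, Set.image_comp]
  exact congrArg (fun D : Flag α => (D : Set α)) h2

theorem IsDistinguished.commute (hd : IsRegularPolytope α d) (hρ : IsDistinguished Φ ρ)
    {i j : Fin d} (hij : (i : ℕ) + 2 ≤ j) : ρ i * ρ j = ρ j * ρ i := by
  obtain ⟨y, hy, x, hx, e⟩ := hd.1.permutes_distinguishedSubgroup hd.2 Φ (a := i) (b := j)
    (by omega) (by omega) (by omega) (ρ i) (hρ.mem hd.1 i) (ρ j) (hρ.mem hd.1 j)
  obtain ⟨F, hF, hr⟩ := hd.1.exists_faceRank_eq Φ (i := i) (by omega) (by omega)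
  obtain ⟨G, hG, hs⟩ := hd.1.exists_faceRank_eq Φ (i := j) (by omega) (by omega)
  have hFi := hρ.apply_ne hd.1 hF hr
  have hGj := hρ.apply_ne hd.1 hG hs
  have hFj := hρ.mem hd.1 j F hF (by omega)
  have hGi := hρ.mem hd.1 i G hG (by omega)
  have e1 : ∀ z, ρ i (ρ j z) = y (x z) := fun z => DFunLike.congr_fun e z
  rcases hρ.eq_one_or_eq hd.1 hx with rfl | rfl
  · exfalso
    have := e1 F
    rw [hFj] at this
    exact hFi (this.trans (hy F hF (by omega)))
  rcases hρ.eq_one_or_eq hd.1 hy with rfl | rfl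
  · exfalso
    have := e1 G
    rw [hGi] at this
    exact hGj ((ρ i).injective (this.trans hGi.symm))
  exact e

/-- The type of a regular polytope does not depend on the base flag. -/
theorem HasSchlafliType.orderOf_eq (hd : IsRegularPolytope α d) {q : ℕ → ℕ}
    (hq : HasSchlafliType α d q) (hρ : IsDistinguished Φ ρ) {i j : Fin d} (hij : (j : ℕ) = i + 1) :
    orderOf (ρ i * ρ j) = q j := by
  obtain ⟨Ψ, τ, hτ, hord⟩ := hq
  obtain ⟨g, -, hg⟩ := hd.2 Ψ Φ
  have key : ∀ m : Fin d, MulAut.conj g (τ m) = ρ m := by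
    intro m
    apply hd.1.eq_of_image_eq (Φ := Φ)
    have h1 : (MulAut.conj g (τ m)) '' (Φ : Set α) = (Flag.map g (Flag.map (τ m) Ψ) : Flag α) := by
      rw [← hg]
      change (g ∘ τ m ∘ g.symm) '' (g '' (Ψ : Set α)) = g '' (τ m '' (Ψ : Set α))
      rw [Set.image_image, Set.image_image]
      simp
    have h2 : IAdjacent (m : ℤ) (Φ : Set α) (Flag.map g (Flag.map (τ m) Ψ) : Flag α) := by
      have := (hτ m).image g
      rwa [hg] at this
    rw [h1]
    exact congrArg (fun D : Flag α => (D : Set α)) (hd.1.eq_of_iAdjacent (by omega) (by omega)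
      (C := Flag.map (ρ m) Φ) h2 (hρ m))
  rw [← hord i j hij, ← key, ← key, ← map_mul]
  exact orderOf_injective (MulAut.conj g).toMonoidHom (MulAut.conj g).injective _

end Distinguished

/-! ### The regular polytope of a string Coxeter group -/

/-- The Coxeter matrix of the string diagram with nodes `0, …, d - 1`, in which the nodes `j - 1` and
`j` are joined by a branch marked `q j`. -/
def stringMatrix (d : ℕ) (q : ℕ → ℕ) (hq : ∀ j, q j ≠ 1) : CoxeterMatrix (Fin d) where
  M := Matrix.of fun i j =>
    if i = j then 1 else if (i : ℕ) + 1 = j then q j else if (j : ℕ) + 1 = i then q i else 2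
  isSymm := by
    ext i j
    simp only [Matrix.transpose_apply, Matrix.of_apply, Fin.ext_iff]
    split_ifs <;> first | rfl | omega
  diagonal := by simp
  off_diagonal := by
    intro i j hij
    simp only [Matrix.of_apply, if_neg hij]
    split_ifs <;> first | exact hq _ | decide

theorem stringMatrix_apply (d : ℕ) (q : ℕ → ℕ) (hq : ∀ j, q j ≠ 1) (i j : Fin d) :
    stringMatrix d q hq i j =
      if i = j then 1 else if (i : ℕ) + 1 = j then q j else if (j : ℕ) + 1 = i then q i else 2 :=
  rfl

namespace CoxeterSystem

variable {B W : Type*} [Group W] {M : CoxeterMatrix B} (cs : CoxeterSystem M W)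

theorem simple_commute_of_eq_two {i j : B} (h : M i j = 2) :
    cs.simple i * cs.simple j = cs.simple j * cs.simple i := by
  have h1 := cs.simple_mul_simple_pow i j
  rw [h, pow_two, mul_eq_one_iff_eq_inv] at h1
  simpa using h1

theorem commute_of_mem_parabolic {J J' : Set B}
    (h : ∀ i ∈ J, ∀ j ∈ J', cs.simple i * cs.simple j = cs.simple j * cs.simple i) {x y : W}
    (hx : x ∈ cs.parabolic J) (hy : y ∈ cs.parabolic J') : x * y = y * x := by
  have h1 : cs.parabolic J ≤ Subgroup.centralizer (cs.simple '' J') := by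
    apply cs.parabolic_le
    intro i hi
    rw [Subgroup.mem_centralizer_iff]
    rintro _ ⟨j, hj, rfl⟩
    exact (h i hi j hj).symm
  have h2 : cs.parabolic J' ≤ Subgroup.centralizer (cs.parabolic J : Set W) := by
    apply cs.parabolic_le
    intro j hj
    rw [Subgroup.mem_centralizer_iff]
    intro z hz
    exact (Subgroup.mem_centralizer_iff.1 (h1 hz) _ ⟨j, hj, rfl⟩).symm
  exact Subgroup.mem_centralizer_iff.1 (h2 hy) x hx

theorem eq_one_or_eq_of_mem_parabolic_singleton {i : B} {w : W} (hw : w ∈ cs.parabolic {i}) :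
    w = 1 ∨ w = cs.simple i := by
  induction hw using Subgroup.closure_induction with
  | mem x hx =>
    obtain ⟨j, rfl, rfl⟩ := hx
    exact Or.inr rfl
  | one => exact Or.inl rfl
  | mul x y _ _ hx hy => rcases hx with rfl | rfl <;> rcases hy with rfl | rfl <;> simp
  | inv x _ hx => rcases hx with rfl | rfl <;> simp

end CoxeterSystem

section RankTwo

variable {G : Type*} [Group G]

theorem encard_image_mk_eq_two {H X : Subgroup G} {s : G} (hs : s ∈ X) (hsH : s ∉ H)
    (hX : ∀ x ∈ X, x = 1 ∨ x = s) : ((fun x : G => (x : G ⧸ H)) '' (X : Set G)).encard = 2 := by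
  have : (X : Set G) = {1, s} := by
    ext x
    constructor
    · exact fun hx => hX x hx
    · rintro (rfl | rfl)
      exacts [X.one_mem, hs]
  rw [this, Set.image_pair, Set.encard_pair]
  rw [Ne, QuotientGroup.eq]
  simpa using hsH

end RankTwo

section String

open CosetFace

variable {d : ℕ} {q : ℕ → ℕ} {hq : ∀ j, q j ≠ 1} {W : Type*} [Group W]
  (cs : CoxeterSystem (stringMatrix d q hq) W)

/-- The subgroups `⟨s_i⟩` for `0 ≤ i ≤ d - 1`; for all other `i` this is the trivial subgroup. -/
def stringSubgroup (i : ℤ) : Subgroup W := cs.parabolic {j | (j : ℤ) = i}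

theorem stringSubgroup_of_fin (i : Fin d) : stringSubgroup cs i = cs.parabolic {i} := by
  rw [stringSubgroup]
  congr 1
  ext j
  simp [Fin.ext_iff]

theorem stringSubgroup_neg_one : stringSubgroup cs (-1) = ⊥ := by
  rw [eq_bot_iff, stringSubgroup]
  apply cs.parabolic_le
  rintro i (hi : (i : ℤ) = -1)
  omega

theorem spannedSubgroup_stringSubgroup (J : Set ℤ) :
    spannedSubgroup (d : ℤ) (stringSubgroup cs) J = cs.parabolic {j | (j : ℤ) ∈ J} := by
  apply le_antisymm
  · refine spannedSubgroup_le ((stringSubgroup_neg_one cs).le.trans bot_le) fun i hi _ _ => ?_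
    apply cs.parabolic_le
    rintro j rfl
    exact cs.simple_mem_parabolic hi
  · apply cs.parabolic_le
    intro j hj
    exact le_spannedSubgroup (R := stringSubgroup cs) (i := (j : ℤ))
      (Or.inr ⟨hj, by omega, by omega⟩) (cs.simple_mem_parabolic rfl)

theorem corankSubgroup_stringSubgroup_le (i : ℤ) :
    corankSubgroup (d : ℤ) (stringSubgroup cs) i ≤ cs.parabolic {j | (j : ℤ) ≠ i} := by
  refine iSup₂_le fun j hj => cs.parabolic_le ?_
  rintro m rfl
  exact cs.simple_mem_parabolic hj.2

theorem simple_notMem_corankSubgroup (i : Fin d) :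
    cs.simple i ∉ corankSubgroup (d : ℤ) (stringSubgroup cs) (i : ℤ) := fun h =>
  cs.simple_mem_parabolic_iff.1 (corankSubgroup_stringSubgroup_le cs _ h) rfl

theorem isRankedSystem_stringSubgroup :
    IsRankedSystem (d : ℤ) d (stringSubgroup cs) fun _ => 2 where
  rank_eq := rfl
  ends := by
    rw [stringSubgroup_neg_one, eq_bot_iff, stringSubgroup]
    apply cs.parabolic_le
    rintro i (hi : (i : ℤ) = d)
    omega
  permutes_base i _ _ := by
    rw [stringSubgroup_neg_one]
    apply Permutes.of_commute
    rintro x rfl y _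
    simp
  permutes i j _ hij _ := by
    apply Permutes.of_commute
    intro x hx y hy
    refine cs.commute_of_mem_parabolic ?_ hx hy
    rintro a (ha : (a : ℤ) = i) b (hb : (b : ℤ) = j)
    apply cs.simple_commute_of_eq_two
    rw [stringMatrix_apply, if_neg (by rintro rfl; omega), if_neg (by omega), if_neg (by omega)]
  generates := by
    rw [spannedSubgroup_stringSubgroup, eq_top_iff, ← cs.subgroup_closure_range_simple,
      CoxeterSystem.parabolic]
    apply Subgroup.closure_mono
    rintro _ ⟨i, rfl⟩
    exact ⟨i, trivial, rfl⟩
  intersection J g hg := by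
    rw [spannedSubgroup_stringSubgroup]
    have h1 : g ∈ cs.parabolic (⋂ i : {i : Fin d // (i : ℤ) ∉ J}, {j | (j : ℤ) ≠ i.1}) := by
      apply cs.mem_parabolic_iInter
      rintro ⟨i, hi⟩
      exact corankSubgroup_stringSubgroup_le cs _ (hg i (by omega) (by omega) hi)
    refine cs.parabolic_le (fun j hj => cs.simple_mem_parabolic ?_) h1
    by_contra hjJ
    exact Set.mem_iInter.1 hj ⟨j, hjJ⟩ rfl
  two_le _ _ := le_rfl
  encard_image i hi := by
    have := stringSubgroup_of_fin cs ⟨i, hi⟩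
    refine encard_image_mk_eq_two (s := cs.simple ⟨i, hi⟩) ?_
      (simple_notMem_corankSubgroup cs ⟨i, hi⟩) ?_
    · exact cs.simple_mem_parabolic rfl
    · intro x hx
      apply cs.eq_one_or_eq_of_mem_parabolic_singleton
      rw [← this]
      exact hx

/-- The flags of the elements `a` and `a s_i` are `i`-adjacent. -/
theorem iAdjacent_flagSet_mul_simple [PartialOrder (CosetFace (d : ℤ) (stringSubgroup cs))]
    (hle : ∀ x y : CosetFace (d : ℤ) (stringSubgroup cs), x ≤ y ↔ x.Le y) (a : W) (i : Fin d) :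
    IAdjacent (i : ℤ) (flagSet (d : ℤ) (stringSubgroup cs) a)
      (flagSet (d : ℤ) (stringSubgroup cs) (a * cs.simple i)) := by
  have hI : (i : ℤ) ∈ Set.Icc (-1) (d : ℤ) := ⟨by omega, by omega⟩
  constructor
  · intro e
    have h1 : (CosetFace.mk ⟨i, hI⟩ a : CosetFace (d : ℤ) (stringSubgroup cs)) ∈
        flagSet (d : ℤ) (stringSubgroup cs) (a * cs.simple i) := e ▸ ⟨_, rfl⟩
    have h2 := mk_eq_mk_iff.1 (mem_flagSet.1 h1)
    rw [inv_mul_cancel_left] at h2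
    exact simple_notMem_corankSubgroup cs i h2
  · intro x hx
    rw [CosetFace.faceRank_eq hle] at hx
    rw [mem_flagSet, mem_flagSet, mk_mul_of_mem]
    refine (isRankedSystem_stringSubgroup cs).spannedSubgroup_le_corankSubgroup x.1.2
      (J := {(i : ℤ)}) hx ?_
    rw [spannedSubgroup_stringSubgroup]
    exact cs.simple_mem_parabolic rfl

end String

section Universal

open CosetFace

universe u

variable {L : Type u} [PartialOrder L] {d : ℕ} {q : ℕ → ℕ}

/-- The distinguished generators of a regular polytope of type `{q 1, …, q (d - 1)}` satisfy the
relations of the string Coxeter group. -/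
theorem IsDistinguished.isLiftable (hq : ∀ j, q j ≠ 1) (hL : IsRegularPolytope L d)
    (htype : HasSchlafliType L d q) {Φ : Flag L} {ρ : Fin d → (L ≃o L)} (hρ : IsDistinguished Φ ρ) :
    (stringMatrix d q hq).IsLiftable ρ := by
  have hinv : ∀ i, (ρ i)⁻¹ = ρ i := fun i => inv_eq_of_mul_eq_one_left (hρ.mul_self hL.1 i)
  intro i j
  rw [stringMatrix_apply]
  split_ifs with h1 h2 h3
  · rw [h1, pow_one, hρ.mul_self hL.1]
  · rw [← htype.orderOf_eq hL hρ h2.symm, pow_orderOf_eq_one]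
  · rw [← htype.orderOf_eq hL hρ h3.symm, show ρ i * ρ j = (ρ j * ρ i)⁻¹ by
      rw [mul_inv_rev, hinv, hinv], inv_pow, pow_orderOf_eq_one, inv_one]
  · have hcomm : ρ i * ρ j = ρ j * ρ i := by
      rcases lt_or_gt_of_ne h1 with h | h
      · exact hρ.commute hL (by omega)
      · exact (hρ.commute hL (by omega)).symm
    rw [pow_two]
    nth_rw 2 [hcomm]
    rw [mul_assoc, ← mul_assoc (ρ j), hρ.mul_self hL.1, one_mul, hρ.mul_self hL.1]

/-- The coset complex of a string Coxeter group is a regular polytope of the given type as soon as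
some regular polytope of this type exists: the latter shows that the products of neighbouring
generators have the orders prescribed by the diagram. -/
theorem exists_polytope_of_coxeterSystem (hq : ∀ j, q j ≠ 1) {W : Type*} [Group W]
    (cs : CoxeterSystem (stringMatrix d q hq) W) (hL : IsRegularPolytope L d)
    (htype : HasSchlafliType L d q) :
    ∃ _ : PartialOrder (CosetFace (d : ℤ) (stringSubgroup cs)),
      (∀ x y : CosetFace (d : ℤ) (stringSubgroup cs), x ≤ y ↔ x.Le y) ∧
      IsRegularPolytope (CosetFace (d : ℤ) (stringSubgroup cs)) d ∧
      HasSchlafliType (CosetFace (d : ℤ) (stringSubgroup cs)) d q := by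
  have h := isRankedSystem_stringSubgroup cs
  let _ := h.partialOrder
  have hle : ∀ x y : CosetFace (d : ℤ) (stringSubgroup cs), x ≤ y ↔ x.Le y := fun _ _ => Iff.rfl
  refine ⟨inferInstance, hle, ⟨h.isIncidenceComplexWith hle, h.isFlagTransitive_top hle⟩,
    cosetFlag hle 1, fun i => IsRankedSystem.translationHom hle (cs.simple i), ?_, ?_⟩
  · intro i
    have h1 := iAdjacent_flagSet_mul_simple cs hle 1 i
    have h2 := translate_image_flagSet (n := (d : ℤ)) (R := stringSubgroup cs) (cs.simple i) 1
    rw [mul_one] at h2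
    rw [one_mul, ← h2] at h1
    exact h1
  · intro i j hij
    have hinj : Function.Injective (IsRankedSystem.translationHom (R := stringSubgroup cs) hle) := by
      rw [injective_iff_map_eq_one]
      intro g hg
      have := h.conj_mem_of_translationHom_eq_one hle hg 1
      rw [stringSubgroup_neg_one, Subgroup.mem_bot] at this
      simpa using this
    rw [← map_mul, orderOf_injective _ hinj]
    apply Nat.dvd_antisymm
    · apply orderOf_dvd_of_pow_eq_one
      have := cs.simple_mul_simple_pow i j
      rwa [stringMatrix_apply, if_neg (by rintro rfl; omega), if_pos hij.symm] at this
    · obtain ⟨Φ, ρ, hρ, hord⟩ := htype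
      have := orderOf_map_dvd (cs.lift ⟨ρ, hρ.isLiftable hq hL ⟨Φ, ρ, hρ, hord⟩⟩)
        (cs.simple i * cs.simple j)
      rwa [map_mul, cs.lift_apply_simple, cs.lift_apply_simple, hord i j hij] at this

/-- The image of a flag under a covering is a flag. -/
theorem IsCovering.isMaxChain_image {P Q : Type*} [PartialOrder P] [PartialOrder Q] {c c' : ℕ → ℕ}
    (hP : IsIncidenceComplexWith P d c) (hQ : IsIncidenceComplexWith Q d c') {f : P → Q}
    (hf : IsCovering f) (Φ : Flag P) : IsMaxChain (· ≤ ·) (f '' (Φ : Set P)) := by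
  apply hQ.isMaxChain_of_forall_rank
  · exact hf.monotone.isChain_image Φ.chain_le
  · intro i h1 h2
    obtain ⟨F, hF, hr⟩ := hP.exists_faceRank_eq Φ h1 h2
    exact ⟨f F, ⟨F, hF, rfl⟩, by rw [hf.rank_eq, hr]⟩

/-- A covering maps `i`-adjacent flags to `i`-adjacent flags. -/
theorem IsCovering.iAdjacent_image {P Q : Type*} [PartialOrder P] [PartialOrder Q] {f : P → Q}
    (hf : IsCovering f) {A B : Flag P} (hAB : AdjacentSets (A : Set P) B) {i : ℤ}
    (hi : IAdjacent i (A : Set P) B) : IAdjacent i (f '' (A : Set P)) (f '' (B : Set P)) := by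
  constructor
  · intro e
    have := (hf.adjacent A B hAB).1
    rw [e, Set.sdiff_self] at this
    simp at this
  · intro F hF
    constructor
    · rintro ⟨G, hG, rfl⟩
      rw [hf.rank_eq] at hF
      exact ⟨G, (hi.2 G hF).1 hG, rfl⟩
    · rintro ⟨G, hG, rfl⟩
      rw [hf.rank_eq] at hF
      exact ⟨G, (hi.2 G hF).2 hG, rfl⟩

theorem IsIncidenceComplexWith.adjacentSets_of_iAdjacent {c : ℕ → ℕ}
    (h : IsIncidenceComplexWith L d c) {A B : Flag L} {i : ℤ} (h0 : -1 ≤ i) (hd : i ≤ d)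
    (hi : IAdjacent i (A : Set L) B) : AdjacentSets (A : Set L) B := by
  have key : ∀ A B : Flag L, IAdjacent i (A : Set L) B → ((A : Set L) \ B).encard = 1 := by
    intro A B hi
    obtain ⟨F, hF, hr⟩ := h.exists_faceRank_eq A h0 hd
    rw [Set.encard_eq_one]
    refine ⟨F, Set.Subset.antisymm ?_ ?_⟩
    · rintro G ⟨hG, hGB⟩
      have : faceRank G = i := by
        by_contra hne
        exact hGB ((hi.2 G hne).1 hG)
      exact h.eq_of_faceRank_eq A.chain_le hG hF (this.trans hr.symm)
    · rintro _ rfl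
      exact ⟨hF, h.not_mem_of_iAdjacent hi hF hr⟩
  exact ⟨key A B hi, key B A hi.symm⟩

/-- The automorphism group of a universal regular polytope is the string Coxeter group of its type.
It is a quotient of the Coxeter group by the relations between distinguished generators. Conversely,
the polytope covers the coset complex of the Coxeter group, and following a flag along a word in the
generators shows that each relation of the group of the polytope holds in the Coxeter group. -/
theorem exists_mulEquiv_of_universal (hq : ∀ j, q j ≠ 1)
    (hL : IsUniversalRegularPolytope L d q) {Φ : Flag L} {ρ : Fin d → (L ≃o L)}
    (hρ : IsDistinguished Φ ρ) :
    ∃ e : (stringMatrix d q hq).Group ≃* (L ≃o L),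
      ∀ i, e ((stringMatrix d q hq).simple i) = ρ i := by
  obtain ⟨hreg, htype, huniv⟩ := hL
  let π := (stringMatrix d q hq).toCoxeterSystem.lift ⟨ρ, hρ.isLiftable hq hreg htype⟩
  have hπ : ∀ i, π ((stringMatrix d q hq).simple i) = ρ i := fun i =>
    (stringMatrix d q hq).toCoxeterSystem.lift_apply_simple _ i
  -- the coset complex has to live in the universe of `L`
  let cs := (stringMatrix d q hq).toCoxeterSystem.map
    (MulEquiv.ulift : ULift.{u} (stringMatrix d q hq).Group ≃* _).symm
  obtain ⟨_, hle, hQ, hQtype⟩ := exists_polytope_of_coxeterSystem hq cs hreg htype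
  obtain ⟨f, hf⟩ := huniv _ hQ hQtype
  have h := isRankedSystem_stringSubgroup cs
  obtain ⟨x, hx⟩ := h.exists_subset_flagSet hle (hf.isMaxChain_image hreg.1 hQ.1 Φ).1
  replace hx := (hf.isMaxChain_image hreg.1 hQ.1 Φ).2 (isChain_flagSet hle x) hx
  have key : ∀ w : (stringMatrix d q hq).Group,
      f '' (π w '' (Φ : Set L)) = flagSet (d : ℤ) (stringSubgroup cs) (x * ULift.up w) := by
    intro w
    induction w using (stringMatrix d q hq).toCoxeterSystem.simple_induction_right with
    | one =>
      rw [map_one]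
      change f '' (id '' (Φ : Set L)) = _
      rw [Set.image_id, hx]
      congr 1
      exact (mul_one x).symm
    | mul_simple_right w i ih =>
      have h1 : IAdjacent (i : ℤ) ((Flag.map (π w) Φ : Flag L) : Set L)
          (Flag.map (π w) (Flag.map (ρ i) Φ) : Flag L) := (hρ i).image (π w)
      have h2 := hf.iAdjacent_image
        (hreg.1.adjacentSets_of_iAdjacent (by omega) (by omega) h1) h1
      have h3 := iAdjacent_flagSet_mul_simple cs hle (x * ULift.up w) i
      have h4 : f '' (Flag.map (π w) Φ : Flag L) =
        (cosetFlag hle (x * ULift.up w) : Set (CosetFace (d : ℤ) (stringSubgroup cs))) := ih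
      rw [h4] at h2
      have h5 := hQ.1.eq_of_iAdjacent (by omega) (by omega)
        (A := cosetFlag hle (x * ULift.up w))
        (B := Flag.ofIsMaxChain _ (hf.isMaxChain_image hreg.1 hQ.1 _))
        (C := cosetFlag hle (x * ULift.up w * cs.simple i)) h2 h3
      have h6 := congrArg
        (fun D : Flag (CosetFace (d : ℤ) (stringSubgroup cs)) =>
          (D : Set (CosetFace (d : ℤ) (stringSubgroup cs)))) h5
      rw [map_mul, CoxeterMatrix.toCoxeterSystem_simple, hπ]
      have h7 : (π w * ρ i) '' (Φ : Set L) = (Flag.map (π w) (Flag.map (ρ i) Φ) : Flag L) :=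
        Set.image_comp (π w) (ρ i) _
      rw [h7]
      refine h6.trans ?_
      change flagSet _ _ _ = _
      rw [mul_assoc]
      rfl
  have hinj : Function.Injective π := by
    rw [injective_iff_map_eq_one]
    intro w hw
    have h1 := key w
    rw [hw] at h1
    change f '' (id '' (Φ : Set L)) = _ at h1
    rw [Set.image_id, hx] at h1
    have h2 := h.mem_of_translate_flagSet (a := x) (g := x * ULift.up w * x⁻¹)
      (by rw [inv_mul_cancel_right]; exact h1.symm)
    rw [stringSubgroup_neg_one, Subgroup.mem_bot] at h2
    have h3 : (ULift.up w : ULift.{u} (stringMatrix d q hq).Group) = 1 := by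
      rw [← h2]
      group
    exact congrArg ULift.down h3
  have hsurj : Function.Surjective π := by
    intro g
    change g ∈ π.range
    refine hreg.1.mem_of_forall_fix hreg.2 Φ (J := Set.univ) ?_ ?_ (fun F _ hF => absurd trivial hF)
    · intro g hg
      have : g = 1 := by
        apply hreg.1.eq_one_of_fix (Φ := Φ)
        have hfix : ∀ F ∈ Φ, g F = F := by
          intro F hF
          by_cases hr : faceRank F = -1
          · exact hreg.1.eq_of_faceRank_eq_neg_one (by rwa [faceRank_orderIso]) hr
          · exact hg F hF hr
        exact (Set.image_congr hfix).trans (Set.image_id _)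
      rw [this]
      exact Subgroup.one_mem _
    · intro j _ h0 hj g hg
      obtain ⟨m, rfl⟩ := Int.eq_ofNat_of_zero_le h0
      rcases hρ.eq_one_or_eq hreg.1 (i := ⟨m, by omega⟩) hg with rfl | rfl
      · exact Subgroup.one_mem _
      · exact ⟨_, hπ _⟩
  exact ⟨MulEquiv.ofBijective π ⟨hinj, hsurj⟩, hπ⟩

end Universal

/-! ### The twisted group -/

theorem Permutes.of_le {G : Type*} [Group G] {X Y : Subgroup G} (h : X ≤ Y) : Permutes X Y :=
  fun x hx y hy => ⟨x * y, Y.mul_mem (h hx) hy, 1, X.one_mem, by simp⟩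

/-- In a regular complex some automorphism moves only the face of a given proper rank of the base
flag. -/
theorem IsIncidenceComplexWith.exists_mem_distinguishedSubgroup {K : Type*} [PartialOrder K]
    {k : ℕ} {c : ℕ → ℕ} (h : IsIncidenceComplexWith K k c)
    (hreg : IsFlagTransitive (⊤ : Subgroup (K ≃o K))) (Φ : Flag K) {a : ℕ} (ha : a < k) :
    ∃ g ∈ distinguishedSubgroup Φ a, ∃ F ∈ Φ, faceRank F = a ∧ g F ≠ F := by
  obtain ⟨F₁, hF₁, hr₁⟩ := h.exists_faceRank_eq Φ (i := (a : ℤ) - 1) (by omega) (by omega)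
  obtain ⟨F₂, hF₂, hr₂⟩ := h.exists_faceRank_eq Φ (i := (a : ℤ) + 1) (by omega) (by omega)
  obtain ⟨F, hF, hr⟩ := h.exists_faceRank_eq Φ (i := a) (by omega) (by omega)
  have hcard := h.card_between a ha F₁ F₂ hr₁ hr₂
    (h.lt_of_faceRank_lt Φ.chain_le hF₁ hF₂ (by omega))
  have h1 : 1 < {H : K | faceRank H = a ∧ F₁ < H ∧ H < F₂}.encard := by
    rw [hcard]
    exact_mod_cast h.two_le a ha
  obtain ⟨H, ⟨hHr, hH1, hH2⟩, hne⟩ := Set.exists_ne_of_one_lt_encard h1 F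
  have hchain : IsChain (· ≤ ·) (insert H {G | G ∈ Φ ∧ faceRank G ≠ a}) := by
    refine (Φ.chain_le.mono fun G hG => hG.1).insert ?_
    rintro G ⟨hG, hGa⟩ _
    rcases lt_or_gt_of_ne hGa with hlt | hgt
    · right
      exact (h.le_of_faceRank_le Φ.chain_le hG hF₁ (by omega)).trans hH1.le
    · left
      exact hH2.le.trans (h.le_of_faceRank_le Φ.chain_le hF₂ hG (by omega))
  obtain ⟨g, hg⟩ := h.exists_automorphism hreg Φ hchain
  refine ⟨g, fun G hG hGa => hg G hG G (Set.mem_insert_of_mem _ ⟨hG, hGa⟩) rfl, F, hF, hr, ?_⟩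
  rw [hg F hF H (Set.mem_insert _ _) (hr.trans hHr.symm)]
  exact hne

section Twist

variable {K : Type*} [PartialOrder K] {d k : ℕ} {q : ℕ → ℕ} {hq : ∀ j, q j ≠ 1}

/-- The node of the merged diagram that belongs to the generator `ρ_i`. -/
def stringNode (d : ℕ) (F₀ : Vertex K) (i : ℕ) : MergedNode K d :=
  if h : i < d - 1 then .inl ⟨i, h⟩ else .inr F₀

theorem stringGenerator_eq (F₀ : Vertex K) (i : ℕ) :
    stringGenerator d q hq F₀ i =
      (mergedMatrix K d q hq).toCoxeterSystem.simple (stringNode d F₀ i) := by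
  unfold stringGenerator stringNode
  split_ifs <;> rfl

theorem mergedMatrix_stringNode (F₀ : Vertex K) (i j : Fin d) :
    mergedMatrix K d q hq (stringNode d F₀ i) (stringNode d F₀ j) = stringMatrix d q hq i j := by
  change mergedEntry K d q (stringNode d F₀ i) (stringNode d F₀ j) = _
  rw [stringMatrix_apply]
  have hi := i.2
  have hj := j.2
  simp only [stringNode, Fin.ext_iff]
  by_cases h1 : (i : ℕ) < d - 1 <;> by_cases h2 : (j : ℕ) < d - 1
  · simp only [dif_pos h1, dif_pos h2, mergedEntry, Fin.ext_iff]
  · have e : (j : ℕ) = d - 1 := by omega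
    rw [dif_pos h1, dif_neg h2, e]
    change (if (i : ℕ) + 2 = d then q (d - 1) else 2) = _
    split_ifs <;> first | rfl | omega
  · have e : (i : ℕ) = d - 1 := by omega
    rw [dif_neg h1, dif_pos h2, e]
    change (if (j : ℕ) + 2 = d then q (d - 1) else 2) = _
    split_ifs <;> first | rfl | omega
  · rw [dif_neg h1, dif_neg h2, if_pos (show (i : ℕ) = j by omega)]
    exact if_pos rfl

/-- The string Coxeter group embeds into the Coxeter group of the merged diagram. A left inverse
identifies the generators that belong to the vertices of `K`. -/
theorem exists_injective_stringGenerator (hd : 1 ≤ d) (F₀ : Vertex K) :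
    ∃ j : (stringMatrix d q hq).Group →* (mergedMatrix K d q hq).Group, Function.Injective j ∧
      ∀ i : Fin d, j ((stringMatrix d q hq).simple i) = stringGenerator d q hq F₀ i := by
  have hj : (stringMatrix d q hq).IsLiftable fun i => stringGenerator d q hq F₀ i := by
    intro i j
    change (stringGenerator d q hq F₀ i * stringGenerator d q hq F₀ j) ^
      stringMatrix d q hq i j = 1
    rw [stringGenerator_eq, stringGenerator_eq, ← mergedMatrix_stringNode F₀ i j,
      CoxeterSystem.simple_mul_simple_pow]
  let p : MergedNode K d → Fin d := Sum.elim (fun i => ⟨i, by omega⟩) fun _ => ⟨d - 1, by omega⟩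
  have hr : (mergedMatrix K d q hq).IsLiftable
      fun x => (stringMatrix d q hq).toCoxeterSystem.simple (p x) := by
    intro x y
    change ((stringMatrix d q hq).toCoxeterSystem.simple (p x) *
      (stringMatrix d q hq).toCoxeterSystem.simple (p y)) ^ mergedMatrix K d q hq x y = 1
    by_cases hxy : p x = p y
    · rw [hxy, CoxeterSystem.simple_mul_simple_self, one_pow]
    · have hnode : ∀ i : Fin (d - 1), stringNode d F₀ (p (.inl i)) = .inl i := fun i =>
        dif_pos i.2
      have hlast : ∀ v, stringNode d F₀ (p (.inr v)) = .inr F₀ := fun v =>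
        dif_neg (lt_irrefl (d - 1))
      have : mergedMatrix K d q hq x y = stringMatrix d q hq (p x) (p y) := by
        rw [← mergedMatrix_stringNode F₀]
        rcases x with i | v <;> rcases y with j | w
        · rw [hnode, hnode]
        · rw [hnode, hlast]
          rfl
        · rw [hnode, hlast]
          rfl
        · exact absurd rfl hxy
      rw [this, CoxeterSystem.simple_mul_simple_pow]
  let f := (stringMatrix d q hq).toCoxeterSystem.lift ⟨_, hj⟩
  let r := (mergedMatrix K d q hq).toCoxeterSystem.lift ⟨_, hr⟩
  have hf : ∀ i : Fin d, f ((stringMatrix d q hq).toCoxeterSystem.simple i) =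
      stringGenerator d q hq F₀ i := fun i =>
    (stringMatrix d q hq).toCoxeterSystem.lift_apply_simple hj i
  refine ⟨f, ?_, hf⟩
  have hrf : r.comp f = MonoidHom.id _ := by
    apply (stringMatrix d q hq).toCoxeterSystem.ext_simple
    intro i
    rw [MonoidHom.comp_apply, hf, stringGenerator_eq]
    refine ((mergedMatrix K d q hq).toCoxeterSystem.lift_apply_simple hr _).trans ?_
    change _ = (stringMatrix d q hq).toCoxeterSystem.simple i
    congr 1
    have hi := i.2
    by_cases h : (i : ℕ) < d - 1
    · simp [stringNode, p, h]
    · simp only [stringNode, p, dif_neg h, Sum.elim_inr, Fin.ext_iff]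
      omega
  exact Function.LeftInverse.injective (g := r) fun x => DFunLike.congr_fun hrf x

theorem coxeterAction_apply (g : K ≃o K) (w : (mergedMatrix K d q hq).Group) :
    coxeterAction K d q hq g w = coxeterEnd d q hq g w := rfl

theorem inr_mul_inl (g : K ≃o K) (w : (mergedMatrix K d q hq).Group) :
    (SemidirectProduct.inr g * SemidirectProduct.inl w : TwistProduct K d q hq) =
      SemidirectProduct.inl (coxeterEnd d q hq g w) * SemidirectProduct.inr g := by
  rw [← coxeterAction_apply, SemidirectProduct.inl_aut, map_inv, inv_mul_cancel_right]

theorem coxeterEnd_mem_parabolic {g : K ≃o K} {A B : Set (MergedNode K d)}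
    (h : ∀ x ∈ A, nodeMap d g x ∈ B) {w : (mergedMatrix K d q hq).Group}
    (hw : w ∈ (mergedMatrix K d q hq).toCoxeterSystem.parabolic A) :
    coxeterEnd d q hq g w ∈ (mergedMatrix K d q hq).toCoxeterSystem.parabolic B := by
  have : (mergedMatrix K d q hq).toCoxeterSystem.parabolic A ≤
      ((mergedMatrix K d q hq).toCoxeterSystem.parabolic B).comap (coxeterEnd d q hq g) := by
    apply CoxeterSystem.parabolic_le
    intro x hx
    rw [Subgroup.mem_comap, CoxeterMatrix.toCoxeterSystem_simple, coxeterEnd_simple]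
    exact (mergedMatrix K d q hq).toCoxeterSystem.simple_mem_parabolic (h x hx)
  exact this hw

theorem coxeterEnd_stringGenerator {F₀ : Vertex K} {g : K ≃o K} {i : ℕ}
    (h : i < d - 1 ∨ g F₀.1 = F₀.1) :
    coxeterEnd d q hq g (stringGenerator d q hq F₀ i) = stringGenerator d q hq F₀ i := by
  unfold stringGenerator
  split_ifs with hi
  · rw [coxeterEnd_simple]
    rfl
  · rw [coxeterEnd_simple]
    congr 1
    exact congrArg Sum.inr (Subtype.ext (h.resolve_left hi))

theorem stringGenerator_mul_self (F₀ : Vertex K) (i : ℕ) :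
    stringGenerator d q hq F₀ i * stringGenerator d q hq F₀ i = 1 := by
  rw [stringGenerator_eq, CoxeterSystem.simple_mul_simple_self]

variable {Φ : Flag K} {F₀ : Vertex K}

theorem hatSubgroup_neg_one : hatSubgroup d q hq Φ F₀ (-1) =
    (distinguishedSubgroup Φ (-1)).map SemidirectProduct.inr := by
  rw [hatSubgroup, if_pos (by norm_num)]

theorem hatSubgroup_of_lt {i : ℤ} (h0 : 0 ≤ i) (hi : i < d) : hatSubgroup d q hq Φ F₀ i =
    Subgroup.zpowers (SemidirectProduct.inl (stringGenerator d q hq F₀ i.toNat)) := by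
  rw [hatSubgroup, if_neg (by omega), if_pos hi]

theorem hatSubgroup_of_le {i : ℤ} (hi : (d : ℤ) ≤ i) : hatSubgroup d q hq Φ F₀ i =
    (distinguishedSubgroup Φ (i - d)).map SemidirectProduct.inr := by
  rw [hatSubgroup, if_neg (by omega), if_neg (by omega)]

theorem eq_one_or_eq_of_mem_zpowers {i : ℕ} {x : TwistProduct K d q hq}
    (hx : x ∈ Subgroup.zpowers
      (SemidirectProduct.inl (stringGenerator d q hq F₀ i) : TwistProduct K d q hq)) :
    x = 1 ∨ x = SemidirectProduct.inl (stringGenerator d q hq F₀ i) := by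
  have h2 : (SemidirectProduct.inl (stringGenerator d q hq F₀ i) : TwistProduct K d q hq) *
      SemidirectProduct.inl (stringGenerator d q hq F₀ i) = 1 := by
    rw [← map_mul, stringGenerator_mul_self, map_one]
  obtain ⟨m, rfl⟩ := Subgroup.mem_zpowers_iff.1 hx
  rcases Int.even_or_odd' m with ⟨r, rfl | rfl⟩
  · left
    rw [zpow_mul, zpow_two, h2, one_zpow]
  · right
    rw [zpow_add, zpow_mul, zpow_two, h2, one_zpow, one_mul, zpow_one]

/-- The nodes of the merged diagram whose generators fix the base face of rank `i`: of the string
all nodes except `i`, and of the vertices of `K` those below the face of rank `i - d` of the base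
flag of `K`. (For `i ≤ d - 2` these are all vertices, since there is no such face, and for `i = d - 1`
there are none.) -/
def supportNodes (d : ℕ) (Φ : Flag K) (i : ℤ) : Set (MergedNode K d) :=
  {x | Sum.elim (fun a : Fin (d - 1) => (a : ℤ) ≠ i)
    (fun v : Vertex K => i ≠ d - 1 ∧ ∀ F ∈ Φ, faceRank F = i - d → v.1 ≤ F) x}

/-- The expected stabilizer of the base face of rank `i`: the semi-direct product of the parabolic subgroup of
`supportNodes d Φ i` and the stabilizer of the face of rank `i - d` of the base flag of `K`. -/
noncomputable def faceSubgroup (d : ℕ) (q : ℕ → ℕ) (hq : ∀ j, q j ≠ 1) (Φ : Flag K) (i : ℤ) :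
    Subgroup (TwistProduct K d q hq) where
  carrier := {x | x.left ∈
    (mergedMatrix K d q hq).toCoxeterSystem.parabolic (supportNodes d Φ i) ∧
      ∀ F ∈ Φ, faceRank F = i - d → x.right F = F}
  one_mem' := ⟨Subgroup.one_mem _, fun _ _ _ => rfl⟩
  mul_mem' := by
    rintro x y ⟨hx, hx'⟩ ⟨hy, hy'⟩
    refine ⟨Subgroup.mul_mem _ hx (coxeterEnd_mem_parabolic ?_ hy), fun F hF hr => ?_⟩
    · rintro (a | v) ha
      · exact ha
      · refine ⟨ha.1, fun F hF hr => ?_⟩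
        rw [← hx' F hF hr]
        exact x.right.monotone (ha.2 F hF hr)
    · change x.right (y.right F) = F
      rw [hy' F hF hr, hx' F hF hr]
  inv_mem' := by
    rintro x ⟨hx, hx'⟩
    have hfix : ∀ F ∈ Φ, faceRank F = i - d → x.right⁻¹ F = F := by
      intro F hF hr
      change x.right.symm F = F
      rw [OrderIso.symm_apply_eq, hx' F hF hr]
    refine ⟨?_, hfix⟩
    rw [SemidirectProduct.inv_left]
    refine coxeterEnd_mem_parabolic ?_ (Subgroup.inv_mem _ hx)
    rintro (a | v) ha
    · exact ha
    · refine ⟨ha.1, fun F hF hr => ?_⟩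
      rw [← hfix F hF hr]
      exact x.right⁻¹.monotone (ha.2 F hF hr)

variable {c : ℕ → ℕ} (h : IsIncidenceComplexWith K k c)
include h

theorem fix_of_mem_distinguishedSubgroup_neg_one {g : K ≃o K}
    (hg : g ∈ distinguishedSubgroup Φ (-1)) {F : K} (hF : F ∈ Φ) : g F = F := by
  by_cases hr : faceRank F = -1
  · exact h.eq_of_faceRank_eq_neg_one (by rwa [faceRank_orderIso]) hr
  · exact hg F hF hr

theorem hatSubgroup_le_faceSubgroup (hd : 1 ≤ d) (hF₀ : F₀.1 ∈ Φ) {i j : ℤ} (h0 : 0 ≤ i)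
    (hj : -1 ≤ j) (hij : j ≠ i) :
    hatSubgroup d q hq Φ F₀ j ≤ faceSubgroup d q hq Φ i := by
  rcases lt_or_ge j 0 with hj0 | hj0
  · obtain rfl : j = -1 := by omega
    rw [hatSubgroup_neg_one]
    rintro _ ⟨g, hg, rfl⟩
    exact ⟨Subgroup.one_mem _, fun F hF _ => fix_of_mem_distinguishedSubgroup_neg_one h hg hF⟩
  rcases lt_or_ge j d with hjd | hjd
  · rw [hatSubgroup_of_lt hj0 hjd, Subgroup.zpowers_le]
    refine ⟨?_, fun F _ _ => rfl⟩
    rw [SemidirectProduct.left_inl, stringGenerator_eq]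
    apply CoxeterSystem.simple_mem_parabolic
    unfold stringNode
    split_ifs with hlt
    · change ((j.toNat : ℕ) : ℤ) ≠ i
      omega
    · refine ⟨by omega, fun F hF hr => ?_⟩
      have h1 := neg_one_le_faceRank F
      have h2 := F₀.2
      exact h.le_of_faceRank_le Φ.chain_le hF₀ hF (by omega)
  · rw [hatSubgroup_of_le hjd]
    rintro _ ⟨g, hg, rfl⟩
    exact ⟨Subgroup.one_mem _, fun F hF hr => hg F hF (by omega)⟩

theorem corankSubgroup_le_faceSubgroup (hd : 1 ≤ d) (hF₀ : F₀.1 ∈ Φ) {n i : ℤ} (h0 : 0 ≤ i) :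
    corankSubgroup n (hatSubgroup d q hq Φ F₀) i ≤ faceSubgroup d q hq Φ i :=
  iSup₂_le fun _ hj => hatSubgroup_le_faceSubgroup h hd hF₀ h0 hj.1.1 hj.2

theorem inr_mem_spannedSubgroup (hreg : IsFlagTransitive (⊤ : Subgroup (K ≃o K))) {J : Set ℤ}
    {g : K ≃o K} (hg : ∀ F ∈ Φ, faceRank F + d ∉ J → g F = F) :
    SemidirectProduct.inr g ∈ spannedSubgroup ((d : ℤ) + k) (hatSubgroup d q hq Φ F₀) J := by
  refine h.mem_of_forall_fix hreg Φ (J := {a | a + d ∈ J})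
    (H := (spannedSubgroup ((d : ℤ) + k) (hatSubgroup d q hq Φ F₀) J).comap
      SemidirectProduct.inr) ?_ ?_ hg
  · rw [← Subgroup.map_le_iff_le_comap, ← hatSubgroup_neg_one (F₀ := F₀)]
    exact le_spannedSubgroup (Set.mem_insert _ _)
  · intro j hj h0 hk
    rw [← Subgroup.map_le_iff_le_comap]
    have := hatSubgroup_of_le (q := q) (hq := hq) (Φ := Φ) (F₀ := F₀) (d := d) (i := j + d) (by omega)
    rw [add_sub_cancel_right] at this
    rw [← this]
    exact le_spannedSubgroup (Or.inr ⟨hj, by omega, by omega⟩)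

/-- A vertex below all base faces of `K` with ranks outside `J` is the image of the base vertex
under an automorphism that fixes these faces. Hence its generator is a conjugate of the
generator of the base vertex in the subgroup generated by the `R̂ j` with `j ∈ J`. -/
theorem inl_mem_spannedSubgroup (hreg : IsFlagTransitive (⊤ : Subgroup (K ≃o K))) (hd : 1 ≤ d)
    (hF₀ : F₀.1 ∈ Φ) {J : Set ℤ} {x : MergedNode K d}
    (hx : ∀ i, 0 ≤ i → i < (d : ℤ) + k → i ∉ J → x ∈ supportNodes d Φ i) :
    SemidirectProduct.inl ((mergedMatrix K d q hq).simple x) ∈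
      spannedSubgroup ((d : ℤ) + k) (hatSubgroup d q hq Φ F₀) J := by
  rcases x with a | v
  · have ha := a.2
    have haJ : ((a : ℕ) : ℤ) ∈ J := by
      by_contra haJ
      exact hx a (by omega) (by omega) haJ rfl
    refine le_spannedSubgroup (i := ((a : ℕ) : ℤ)) (Or.inr ⟨haJ, by omega, by omega⟩) ?_
    rw [hatSubgroup_of_lt (by omega) (by omega), Int.toNat_natCast, stringGenerator, dif_pos ha]
    exact Subgroup.mem_zpowers _
  · have hdJ : (d : ℤ) - 1 ∈ J := by
      by_contra hdJ
      exact (hx (d - 1) (by omega) (by omega) hdJ).1 rfl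
    have hchain : IsChain (· ≤ ·) (insert v.1 {F | F ∈ Φ ∧ faceRank F + d ∉ J}) := by
      refine (Φ.chain_le.mono fun F hF => hF.1).insert ?_
      rintro F ⟨hF, hFJ⟩ _
      have h1 := neg_one_le_faceRank F
      have h2 := h.faceRank_le F
      by_cases e1 : faceRank F = -1
      · exact Or.inr (h.isBot_of_faceRank_eq e1 _)
      by_cases e2 : faceRank F = k
      · exact Or.inl (h.isTop_of_faceRank_eq e2 _)
      · exact Or.inl ((hx (faceRank F + d) (by omega) (by omega) hFJ).2 F hF (by omega))
    obtain ⟨g, hg⟩ := h.exists_automorphism hreg Φ hchain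
    have hgv : g F₀.1 = v.1 := hg _ hF₀ _ (Set.mem_insert _ _) (F₀.2.trans v.2.symm)
    have hgJ := inr_mem_spannedSubgroup (q := q) (hq := hq) (F₀ := F₀) h hreg (J := J) (g := g)
      fun F hF hFJ => hg F hF F (Set.mem_insert_of_mem _ ⟨hF, hFJ⟩) rfl
    have hconj : (SemidirectProduct.inl ((mergedMatrix K d q hq).simple (Sum.inr v)) :
        TwistProduct K d q hq) = SemidirectProduct.inr g *
          SemidirectProduct.inl ((mergedMatrix K d q hq).simple (Sum.inr F₀)) *
          (SemidirectProduct.inr g)⁻¹ := by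
      have hnode : nodeMap d g (Sum.inr F₀) = Sum.inr v := congrArg Sum.inr (Subtype.ext hgv)
      rw [inr_mul_inl, coxeterEnd_simple, mul_inv_cancel_right, hnode]
    rw [hconj]
    refine Subgroup.mul_mem _ (Subgroup.mul_mem _ hgJ ?_) (Subgroup.inv_mem _ hgJ)
    refine le_spannedSubgroup (i := (d : ℤ) - 1) (Or.inr ⟨hdJ, by omega, by omega⟩) ?_
    rw [hatSubgroup_of_lt (by omega) (by omega), stringGenerator, dif_neg (by omega)]
    exact Subgroup.mem_zpowers _

theorem mem_spannedSubgroup_of_forall_mem (hreg : IsFlagTransitive (⊤ : Subgroup (K ≃o K)))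
    (hd : 1 ≤ d) (hF₀ : F₀.1 ∈ Φ) {J : Set ℤ} {x : TwistProduct K d q hq}
    (hx : ∀ i, 0 ≤ i → i < (d : ℤ) + k → i ∉ J → x ∈ faceSubgroup d q hq Φ i) :
    x ∈ spannedSubgroup ((d : ℤ) + k) (hatSubgroup d q hq Φ F₀) J := by
  rw [← SemidirectProduct.inl_left_mul_inr_right x]
  refine Subgroup.mul_mem _ ?_ (inr_mem_spannedSubgroup h hreg fun F hF hFJ => ?_)
  · have h1 : x.left ∈ (mergedMatrix K d q hq).toCoxeterSystem.parabolic
        (⋂ i : {i : ℤ // 0 ≤ i ∧ i < (d : ℤ) + k ∧ i ∉ J}, supportNodes d Φ i.1) :=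
      CoxeterSystem.mem_parabolic_iInter _ fun i => (hx i.1 i.2.1 i.2.2.1 i.2.2.2).1
    have h2 := CoxeterSystem.parabolic_le (H := (spannedSubgroup ((d : ℤ) + k)
      (hatSubgroup d q hq Φ F₀) J).comap SemidirectProduct.inl) _ (fun y hy => ?_) h1
    · exact h2
    · exact inl_mem_spannedSubgroup h hreg hd hF₀ fun i h0 hn hi =>
        Set.mem_iInter.1 hy ⟨i, h0, hn, hi⟩
  · have h1 := neg_one_le_faceRank F
    have h2 := h.faceRank_le F
    by_cases e1 : faceRank F = -1
    · exact h.eq_of_faceRank_eq_neg_one (by rwa [faceRank_orderIso]) e1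
    by_cases e2 : faceRank F = k
    · exact h.eq_of_faceRank_eq_top (by rwa [faceRank_orderIso]) e2
    · exact (hx (faceRank F + d) (by omega) (by omega) hFJ).2 F hF (by omega)

/-- The group is generated by the subgroups `R̂ 0, …, R̂ (d + k - 1)`. -/
theorem twistGroup_eq_top (hreg : IsFlagTransitive (⊤ : Subgroup (K ≃o K))) (hd : 1 ≤ d)
    (hk : 1 ≤ k) (hF₀ : F₀.1 ∈ Φ) : twistGroup d k q hq Φ F₀ = ⊤ := by
  rw [eq_top_iff]
  intro x _
  have hx := mem_spannedSubgroup_of_forall_mem h hreg hd hF₀ (J := Set.univ) (x := x)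
    (fun i _ _ hi => absurd trivial hi)
  refine spannedSubgroup_le ?_ (fun i _ h0 hn => ?_) hx
  · have h1 : hatSubgroup d q hq Φ F₀ (-1) ≤ hatSubgroup d q hq Φ F₀ d := by
      rw [hatSubgroup_neg_one, hatSubgroup_of_le le_rfl]
      exact Subgroup.map_mono (distinguishedSubgroup_neg_one_le h)
    exact h1.trans (le_biSup (hatSubgroup d q hq Φ F₀)
      (show (d : ℤ) ∈ Set.Icc (0 : ℤ) (d + k - 1) from ⟨by omega, by omega⟩))
  · exact le_biSup (hatSubgroup d q hq Φ F₀)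
      (show i ∈ Set.Icc (0 : ℤ) (d + k - 1) from ⟨h0, by omega⟩)

omit h in
theorem permutes_of_fix {i : ℤ} (h0 : 0 ≤ i) (hi : i < d) {X : Subgroup (K ≃o K)}
    (hX : ∀ g ∈ X, i < d - 1 ∨ g F₀.1 = F₀.1) :
    Permutes (hatSubgroup d q hq Φ F₀ i) (X.map SemidirectProduct.inr) := by
  rw [hatSubgroup_of_lt h0 hi]
  apply Permutes.of_commute
  rintro x hx _ ⟨g, hg, rfl⟩
  rcases eq_one_or_eq_of_mem_zpowers hx with rfl | rfl
  · simp
  · rw [inr_mul_inl, coxeterEnd_stringGenerator]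
    rcases hX g hg with h1 | h1
    · left
      omega
    · exact Or.inr h1

theorem permutes_hatSubgroup (hreg : IsFlagTransitive (⊤ : Subgroup (K ≃o K)))
    (hF₀ : F₀.1 ∈ Φ) {i j : ℤ} (h0 : 0 ≤ i) (hij : i + 2 ≤ j) (hj : j < (d : ℤ) + k) :
    Permutes (hatSubgroup d q hq Φ F₀ i) (hatSubgroup d q hq Φ F₀ j) := by
  rcases lt_or_ge j d with hjd | hjd
  · rw [hatSubgroup_of_lt h0 (by omega), hatSubgroup_of_lt (by omega) hjd]
    have hcomm : stringGenerator d q hq F₀ i.toNat * stringGenerator d q hq F₀ j.toNat =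
        stringGenerator d q hq F₀ j.toNat * stringGenerator d q hq F₀ i.toNat := by
      rw [stringGenerator_eq, stringGenerator_eq]
      apply CoxeterSystem.simple_commute_of_eq_two
      have := mergedMatrix_stringNode (q := q) (hq := hq) F₀ (⟨i.toNat, by omega⟩ : Fin d)
        ⟨j.toNat, by omega⟩
      refine this.trans ?_
      rw [stringMatrix_apply, if_neg, if_neg, if_neg]
      · dsimp only
        omega
      · dsimp only
        omega
      · rw [Fin.ext_iff]
        dsimp only
        omega
    apply Permutes.of_commute
    intro x hx y hy
    rcases eq_one_or_eq_of_mem_zpowers hx with rfl | rfl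
    · simp
    rcases eq_one_or_eq_of_mem_zpowers hy with rfl | rfl
    · simp
    rw [← map_mul, hcomm, map_mul]
  rcases lt_or_ge i d with hid | hid
  · rw [hatSubgroup_of_le hjd]
    refine permutes_of_fix h0 hid fun g hg => ?_
    by_cases e : i < d - 1
    · exact Or.inl e
    · have := F₀.2
      exact Or.inr (hg _ hF₀ (by omega))
  · rw [hatSubgroup_of_le hjd, hatSubgroup_of_le hid]
    exact (h.permutes_distinguishedSubgroup hreg Φ (by omega) (by omega) (by omega)).map _

theorem finite_and_two_le [Finite K] (hreg : IsFlagTransitive (⊤ : Subgroup (K ≃o K)))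
    (hd : 1 ≤ d) (hF₀ : F₀.1 ∈ Φ) {n : ℤ} {i : ℕ} (hi : i < d + k) :
    ((fun s : TwistProduct K d q hq =>
        (s : TwistProduct K d q hq ⧸ corankSubgroup n (hatSubgroup d q hq Φ F₀) (i : ℤ))) ''
      (hatSubgroup d q hq Φ F₀ i : Set (TwistProduct K d q hq))).Finite ∧
    2 ≤ ((fun s : TwistProduct K d q hq =>
        (s : TwistProduct K d q hq ⧸ corankSubgroup n (hatSubgroup d q hq Φ F₀) (i : ℤ))) ''
      (hatSubgroup d q hq Φ F₀ i : Set (TwistProduct K d q hq))).ncard := by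
  have hle := corankSubgroup_le_faceSubgroup (q := q) (hq := hq) (n := n) h hd hF₀
    (i := (i : ℤ)) (by omega)
  rcases lt_or_ge i d with hid | hid
  · rw [hatSubgroup_of_lt (by omega) (by omega), Int.toNat_natCast]
    have hcard := encard_image_mk_eq_two
      (H := corankSubgroup n (hatSubgroup d q hq Φ F₀) (i : ℤ))
      (s := (SemidirectProduct.inl (stringGenerator d q hq F₀ i) : TwistProduct K d q hq))
      (Subgroup.mem_zpowers _) ?_ (fun x hx => eq_one_or_eq_of_mem_zpowers hx)
    · refine ⟨Set.finite_of_encard_eq_coe (k := 2) hcard, ?_⟩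
      rw [Set.ncard, hcard]
      rfl
    · intro hmem
      have h1 := (hle hmem).1
      rw [SemidirectProduct.left_inl, stringGenerator_eq, CoxeterSystem.simple_mem_parabolic_iff]
        at h1
      unfold stringNode at h1
      split_ifs at h1 with hlt
      · exact h1 rfl
      · exact h1.1 (by omega)
  · rw [hatSubgroup_of_le (by omega)]
    have hfin : ((fun s : TwistProduct K d q hq =>
        (s : TwistProduct K d q hq ⧸ corankSubgroup n (hatSubgroup d q hq Φ F₀) (i : ℤ))) ''
        ((distinguishedSubgroup Φ ((i : ℤ) - d)).map SemidirectProduct.inr :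
          Subgroup (TwistProduct K d q hq))).Finite := by
      have : Finite (K ≃o K) := DFunLike.finite _
      apply Set.Finite.image
      rw [Subgroup.coe_map]
      exact (Set.toFinite _).image _
    refine ⟨hfin, ?_⟩
    obtain ⟨g, hg, F, hF, hr, hne⟩ :=
      h.exists_mem_distinguishedSubgroup hreg Φ (a := i - d) (by omega)
    rw [show ((i - d : ℕ) : ℤ) = (i : ℤ) - d by omega] at hg hr
    change 1 < _
    rw [Set.one_lt_ncard hfin]
    refine ⟨_, ⟨1, Subgroup.one_mem _, rfl⟩, _, ⟨SemidirectProduct.inr g, ⟨g, hg, rfl⟩, rfl⟩, ?_⟩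
    dsimp only
    rw [Ne, QuotientGroup.eq, inv_one, one_mul]
    intro hmem
    exact hne ((hle hmem).2 F hF hr)

theorem isRankedSystem_hatSubgroup [Finite K] (hreg : IsFlagTransitive (⊤ : Subgroup (K ≃o K)))
    (hd : 1 ≤ d) (hF₀ : F₀.1 ∈ Φ) :
    IsRankedSystem ((d : ℤ) + k) (d + k) (hatSubgroup d q hq Φ F₀) fun i =>
      ((fun s : TwistProduct K d q hq => (s : TwistProduct K d q hq ⧸
        corankSubgroup ((d : ℤ) + k) (hatSubgroup d q hq Φ F₀) (i : ℤ))) ''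
        (hatSubgroup d q hq Φ F₀ i : Set (TwistProduct K d q hq))).ncard where
  rank_eq := by push_cast; rfl
  ends := by
    rw [hatSubgroup_neg_one, hatSubgroup_of_le (by omega), add_sub_cancel_left]
    congr 1
    apply le_antisymm _ (distinguishedSubgroup_neg_one_le h)
    intro g hg F hF _
    by_cases hr : faceRank F = k
    · exact h.eq_of_faceRank_eq_top (by rwa [faceRank_orderIso]) hr
    · exact hg F hF hr
  permutes_base i h0 hi := by
    rw [hatSubgroup_neg_one]
    rcases lt_or_ge i d with hid | hid
    · refine (permutes_of_fix h0 hid fun g hg => Or.inr ?_).symm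
      exact fix_of_mem_distinguishedSubgroup_neg_one h hg hF₀
    · rw [hatSubgroup_of_le hid]
      exact Permutes.of_le (Subgroup.map_mono (distinguishedSubgroup_neg_one_le h))
  permutes i j h0 hij hj := permutes_hatSubgroup h hreg hF₀ h0 hij hj
  generates := by
    rw [eq_top_iff]
    intro x _
    exact mem_spannedSubgroup_of_forall_mem h hreg hd hF₀ fun i _ _ hi => absurd trivial hi
  intersection J x hx := mem_spannedSubgroup_of_forall_mem h hreg hd hF₀ fun i h0 hn hi =>
    corankSubgroup_le_faceSubgroup h hd hF₀ h0 (hx i h0 hn hi)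
  two_le i hi := (finite_and_two_le h hreg hd hF₀ hi).2
  encard_image i hi := (finite_and_two_le h hreg hd hF₀ hi).1.cast_ncard_eq.symm

omit h in
/-- An element all of whose conjugates fix the base flag is trivial: it is an automorphism of `K` that
commutes with the generators of `W`, hence fixes the vertices. -/
theorem eq_one_of_forall_conj_mem (hKv : IsVertexDescribable K) {x : TwistProduct K d q hq}
    (hx : ∀ a, a⁻¹ * x * a ∈ hatSubgroup d q hq Φ F₀ (-1)) : x = 1 := by
  rw [hatSubgroup_neg_one] at hx
  obtain ⟨g, hg, hgx⟩ := hx 1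
  rw [inv_one, one_mul, mul_one] at hgx
  subst hgx
  have hv : ∀ v : Vertex K, vertexMap g v = v := by
    intro v
    obtain ⟨g', -, hg'⟩ := hx (SemidirectProduct.inl ((mergedMatrix K d q hq).simple (Sum.inr v)))
    rw [mul_assoc, inr_mul_inl, ← mul_assoc, ← map_inv, ← map_mul] at hg'
    have h1 := congrArg SemidirectProduct.left hg'
    rw [SemidirectProduct.mul_left, SemidirectProduct.left_inl, SemidirectProduct.left_inr,
      SemidirectProduct.left_inr, map_one, mul_one, eq_comm, inv_mul_eq_one,
      coxeterEnd_simple] at h1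
    have h2 := (mergedMatrix K d q hq).toCoxeterSystem.simple_injective h1
    exact (Sum.inr_injective h2).symm
  have : g = 1 := by
    ext F
    refine hKv _ _ fun v => ?_
    have h1 : g v.1 = v.1 := congrArg Subtype.val (hv v)
    change v.1 ≤ g F ↔ v.1 ≤ F
    rw [← h1, g.le_iff_le, h1]
  rw [this, map_one]

end Twist

theorem theorem6p1 {L : Type*} [PartialOrder L] {K : Type*} [PartialOrder K] [Finite K]
    (d k : ℕ) (hd : 1 ≤ d) (hk : 1 ≤ k)
    (q : ℕ → ℕ) (hq : ∀ j, q j ≠ 1)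
    (hL : IsUniversalRegularPolytope L d q)
    (ΦL : Flag L) (ρ : Fin d → (L ≃o L)) (hρ : IsDistinguished ΦL ρ)
    (hK : IsRegularComplex K k) (hKv : IsVertexDescribable K)
    (Φ : Flag K) (F₀ : Vertex K) (hF₀ : F₀.1 ∈ Φ) :
    -- `Γ(L)` is a subgroup of `W`, with `ρ_i` as in the definition of the `R̂ i`
    (∃ ι : (L ≃o L) →* (mergedMatrix K d q hq).Group, Function.Injective ι ∧
      ∀ i : Fin d, ι (ρ i) = stringGenerator d q hq F₀ i) ∧
    -- `Γ = W ⋊ Γ(K)`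
    twistGroup d k q hq Φ F₀ = ⊤ ∧
    -- the cosets form a regular complex of rank `d + k`, and `Γ` is (by left translation) a
    -- flag-transitive subgroup of its automorphism group
    ∃ _ : PartialOrder (TwistComplex d k q hq Φ F₀),
      (∀ x y : TwistComplex d k q hq Φ F₀, x ≤ y ↔ x.Le y) ∧
      IsRegularComplex (TwistComplex d k q hq Φ F₀) (d + k) ∧
      ∃ f : twistGroup d k q hq Φ F₀ →*
          (TwistComplex d k q hq Φ F₀ ≃o TwistComplex d k q hq Φ F₀),
        Function.Injective f ∧
        (∀ (g : twistGroup d k q hq Φ F₀) (x : TwistComplex d k q hq Φ F₀),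
          f g x = CosetFace.translate (g : TwistProduct K d q hq) x) ∧
        IsFlagTransitive f.range := by
  obtain ⟨⟨c, h⟩, hreg⟩ := hK
  have htop := twistGroup_eq_top (q := q) (hq := hq) h hreg hd hk hF₀
  have hsys := isRankedSystem_hatSubgroup (q := q) (hq := hq) h hreg hd hF₀
  refine ⟨?_, htop, ?_⟩
  · obtain ⟨e, he⟩ := exists_mulEquiv_of_universal hq hL hρ
    obtain ⟨j, hj, hj'⟩ := exists_injective_stringGenerator (q := q) (hq := hq) hd F₀
    refine ⟨j.comp e.symm.toMonoidHom, hj.comp e.symm.injective, fun i => ?_⟩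
    rw [← hj', ← he]
    change j (e.symm (e _)) = _
    rw [e.symm_apply_apply]
  · let _ := hsys.partialOrder
    have hle : ∀ x y : TwistComplex d k q hq Φ F₀, x ≤ y ↔ x.Le y := fun _ _ => Iff.rfl
    refine ⟨inferInstance, hle, ⟨⟨_, hsys.isIncidenceComplexWith hle⟩,
      hsys.isFlagTransitive_top hle⟩,
      (IsRankedSystem.translationHom hle).comp (twistGroup d k q hq Φ F₀).subtype, ?_, ?_, ?_⟩
    · rw [injective_iff_map_eq_one]
      intro x hx
      apply Subtype.ext
      exact eq_one_of_forall_conj_mem hKv fun a => hsys.conj_mem_of_translationHom_eq_one hle hx a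
    · intro g x
      rfl
    · intro A B
      obtain ⟨_, ⟨x, rfl⟩, hx⟩ := hsys.isFlagTransitive_range hle A B
      exact ⟨_, ⟨⟨x, htop ▸ Subgroup.mem_top x⟩, rfl⟩, hx⟩
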